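/- Let $d\in\mathbb N$ and let $\mathcal P_2(\mathbb R^d)$ be the set of Borel probability measures on $\mathbb R^d$ with finite second order moment. For $\mu,\eta\in\mathcal P_2(\mathbb R^d)$ let $W_2^2(\mu,\eta)=\inf_\pi\int|y-x|^2\,\pi(dx,dy)$, where $\pi$ runs over the couplings of $\mu$ and $\eta$. For probability measures write $\eta\le_{\rm cx}\nu$ (convex order) if $\int\phi\,d\eta\le\int\phi\,d\nu$ for each convex $\phi:\mathbb R^d\to\mathbb R$ for which both integrals make sense in $[-\infty,\infty]$. For $\mu,\nu\in\mathcal P_2(\mathbb R^d)$ let $$\mathcal I_\mu^\nu=\Big\{\eta\in\mathcal P_2(\mathbb R^d):\ \eta\le_{\rm cx}\nu,\ W_2^2(\mu,\nu)=W_2^2(\mu,\eta)+\int|y|^2\nu(dy)-\int|z|^2\eta(dz)\Big\},$$ and for $\phi:\mathbb R^d\to\mathbb R$ strictly convex with $\int\phi\,d\nu<\infty$ let $\mathcal I_{\mu,\phi}^\nu$ be the set of the minimizers of $\eta\mapsto\int\phi\,d\eta$ over $\mathcal I_\mu^\nu$. For all $\mu,\nu\in\mathcal P_2(\mathbb R^d)$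 and every such $\phi$, there is exactly one minimizer $\eta_\phi$ of $\eta\mapsto\int|z|^2\eta(dz)$ over $\mathcal I_{\mu,\phi}^\nu$, and the set $\mathcal I_{\mu,|x|^2}^\nu$ has exactly one element $\underline\eta$. With these notations, there exists $\eta_0\in\mathcal P_2(\mathbb R^d)$ such that $\mathcal I_\mu^\nu=\{\eta:\ \eta_0\le_{\rm cx}\eta\le_{\rm cx}\nu\}$ if and only if $$\Big\{\eta_\phi:\ \phi:\mathbb R^d\to\mathbb R\text{ strictly convex with }\int\phi\,d\nu<\infty\Big\}=\{\underline\eta\},$$ and in that case $\eta_0=\underline\eta$. -/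

import Mathlib

open MeasureTheory
open scoped ENNReal

namespace QuadOT

/-- The Euclidean space `ℝ^d`. -/
abbrev E (d : ℕ) : Type := EuclideanSpace ℝ (Fin d)

/-- `P₂(ℝ^d)`: Borel probability measures on `ℝ^d` with finite second order moment. -/
def P2 (d : ℕ) : Set (Measure (E d)) :=
  {μ | IsProbabilityMeasure μ ∧ ∫⁻ x, ‖x‖ₑ ^ 2 ∂μ < ∞}

/-- `Π(μ, ν)`: measures on `ℝ^d × ℝ^d` with first marginal `μ` and second marginal `ν`. -/
def couplings {d : ℕ} (μ ν : Measure (E d)) : Set (Measure (E d × E d)) :=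
  {π | π.fst = μ ∧ π.snd = ν}

/-- The squared quadratic Wasserstein distance
`W₂²(μ, ν) = inf_{π ∈ Π(μ, ν)} ∫ |y - x|² π(dx, dy)`. -/
noncomputable def W2sq {d : ℕ} (μ ν : Measure (E d)) : ℝ≥0∞ :=
  ⨅ π ∈ couplings μ ν, ∫⁻ p, ‖p.2 - p.1‖ₑ ^ 2 ∂π

/-- The integral `∫ φ dη` makes sense in `[-∞, ∞]`: the positive or the negative part of `φ`
has a finite integral. -/
def IntegralMakesSense {d : ℕ} (η : Measure (E d)) (φ : E d → ℝ) : Prop :=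
  ∫⁻ x, ENNReal.ofReal (φ x) ∂η < ∞ ∨ ∫⁻ x, ENNReal.ofReal (-φ x) ∂η < ∞

/-- The integral `∫ φ dη ∈ [-∞, ∞]`, as the integral of the positive part minus the integral of
the negative part (meaningful under `IntegralMakesSense η φ`). -/
noncomputable def extIntegral {d : ℕ} (η : Measure (E d)) (φ : E d → ℝ) : EReal :=
  ((∫⁻ x, ENNReal.ofReal (φ x) ∂η : ℝ≥0∞) : EReal) -
    ((∫⁻ x, ENNReal.ofReal (-φ x) ∂η : ℝ≥0∞) : EReal)

/-- The convex order `η ≤_cx ν`: `∫ φ dη ≤ ∫ φ dν` for each convex `φ : ℝ^d → ℝ` for which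
both integrals make sense. -/
def CxLE {d : ℕ} (η ν : Measure (E d)) : Prop :=
  ∀ φ : E d → ℝ, ConvexOn ℝ Set.univ φ → IntegralMakesSense η φ → IntegralMakesSense ν φ →
    extIntegral η φ ≤ extIntegral ν φ

/-- The set `𝓘_μ^ν` of all `η ∈ P₂(ℝ^d)` with `η ≤_cx ν` and
`W₂²(μ, ν) = W₂²(μ, η) + ∫ |y|² ν(dy) - ∫ |z|² η(dz)`. -/
def I {d : ℕ} (μ ν : Measure (E d)) : Set (Measure (E d)) :=
  {η | η ∈ P2 d ∧ CxLE η ν ∧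
    (W2sq μ ν).toReal = (W2sq μ η).toReal + ∫ y, ‖y‖ ^ 2 ∂ν - ∫ z, ‖z‖ ^ 2 ∂η}

/-- The interval `{η : η₀ ≤_cx η ≤_cx ν}` of probability measures for the convex order. -/
def cxInterval {d : ℕ} (η₀ ν : Measure (E d)) : Set (Measure (E d)) :=
  {η | IsProbabilityMeasure η ∧ CxLE η₀ η ∧ CxLE η ν}

/-- The minimizers over a set `S` of measures of the integral of `φ`. -/
def minimizers {d : ℕ} (S : Set (Measure (E d))) (φ : E d → ℝ) : Set (Measure (E d)) :=
  {η | η ∈ S ∧ ∀ η' ∈ S, extIntegral η φ ≤ extIntegral η' φ}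

/-- The set `𝓘_{μ,φ}^ν` of the elements of `𝓘_μ^ν` that minimize the integral of `φ`. -/
def Iphi {d : ℕ} (μ ν : Measure (E d)) (φ : E d → ℝ) : Set (Measure (E d)) :=
  minimizers (I μ ν) φ

/-- `φ : ℝ^d → ℝ` is strictly convex and `∫ φ dν < ∞`. (For `ν ∈ P₂(ℝ^d)` the negative part of
a convex function always has a finite integral, so only the positive part matters.) -/
def Admissible {d : ℕ} (ν : Measure (E d)) (φ : E d → ℝ) : Prop :=
  StrictConvexOn ℝ Set.univ φ ∧ ∫⁻ y, ENNReal.ofReal (φ y) ∂ν < ∞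

/-- `η` is the measure `η_φ`: it belongs to `𝓘_{μ,φ}^ν` and it minimizes the second order
moment over `𝓘_{μ,φ}^ν`. -/
def IsEtaPhi {d : ℕ} (μ ν : Measure (E d)) (φ : E d → ℝ) (η : Measure (E d)) : Prop :=
  η ∈ minimizers (Iphi μ ν φ) (fun z => ‖z‖ ^ 2)

end QuadOT

open QuadOT

/-!
Expanding `|y - x|²` turns `W₂²` into the maximal correlation `∫ ⟨x, y⟩ dπ` of a coupling, and the
identity defining `𝓘_μ^ν` says that the maximal correlations with `μ` of `η` and of `ν` agree. The
key point is that a coupling of `μ` with `η` can be replaced by one of `μ` with any measure above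
`η` in the convex order without lowering the correlation: for `μ` finitely supported this is a
separation argument, in which the maximum of finitely many affine functions is tested against the
order, and the general case follows by approximating `μ`. Hence `𝓘_μ^ν` is the set of the
`η ≤_cx ν` having a coupling with `μ` of correlation at least the maximum `c` for `ν`, and it
contains, with each of its elements, everything between that element and `ν`.

Such a superlevel set is compact enough for `∫ φ dη` to attain its minimum. The minimizer is
unique, since gluing two optimal couplings along `μ` and mixing their second coordinates gives
an element of the set with a smaller integral of `φ` unless the two laws coincide. So each
`𝓘_{μ,φ}^ν` is a singleton; that it is the same singleton for all `φ` means that its element is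
below every element of `𝓘_μ^ν`, as strictly convex functions suffice to test the convex order.
-/

namespace QuadOT

open Filter Set Topology

section InnerProductSpace

variable {V : Type*} [NormedAddCommGroup V] [InnerProductSpace ℝ V]

theorem strictConvexOn_add_const_mul_norm_sq {φ : V → ℝ} (hφ : ConvexOn ℝ univ φ) {ε : ℝ}
    (hε : 0 < ε) : StrictConvexOn ℝ univ fun x => φ x + ε * ‖x‖ ^ 2 := by
  have h : StrongConvexOn univ (2 * ε) fun x => φ x + ε * ‖x‖ ^ 2 :=
    strongConvexOn_iff_convex.2 (by simpa using hφ)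
  exact h.strictConvexOn (by positivity)

theorem strictConvexOn_norm_sq : StrictConvexOn ℝ univ fun x : V => ‖x‖ ^ 2 := by
  simpa using strictConvexOn_add_const_mul_norm_sq (convexOn_const (0 : ℝ) convex_univ) one_pos

end InnerProductSpace

section ConvexFunctions

variable {V : Type*} [NormedAddCommGroup V] [NormedSpace ℝ V]

theorem convexOn_clm_add_const (L : V →L[ℝ] ℝ) (c : ℝ) : ConvexOn ℝ univ fun x => L x + c :=
  (L.toLinearMap.convexOn convex_univ).add_const c

theorem concaveOn_clm_add_const (L : V →L[ℝ] ℝ) (c : ℝ) : ConcaveOn ℝ univ fun x => L x + c :=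
  (L.toLinearMap.concaveOn convex_univ).add_const c

variable [FiniteDimensional ℝ V] {φ : V → ℝ}

theorem continuous_of_convexOn (hφ : ConvexOn ℝ univ φ) : Continuous φ :=
  continuousOn_univ.1 (hφ.continuousOn isOpen_univ)

theorem exists_clm_add_const_le (hφ : ConvexOn ℝ univ φ) :
    ∃ (L : V →L[ℝ] ℝ) (c : ℝ), ∀ x, L x + c ≤ φ x := by
  obtain ⟨l, c, hl, -⟩ := hφ.real_univ_sSup_of_nat_affine_eq
    (continuous_of_convexOn hφ).lowerSemicontinuous
  exact ⟨l 0, c 0, fun x => hl 0 x⟩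

theorem exists_monotone_linearGrowth_tendsto (hφ : ConvexOn ℝ univ φ) (h0 : ∀ x, 0 ≤ φ x) :
    ∃ f : ℕ → V → ℝ, Monotone f ∧ (∀ x, Tendsto (f · x) atTop (𝓝 (φ x))) ∧
      ∀ n, ConvexOn ℝ univ (f n) ∧ (∀ x, 0 ≤ f n x) ∧ ∃ K, ∀ x, f n x ≤ K * (1 + ‖x‖) := by
  obtain ⟨l, c, hle, hsup⟩ := hφ.real_univ_sSup_of_nat_affine_eq
    (continuous_of_convexOn hφ).lowerSemicontinuous
  let g : ℕ → V → ℝ := fun i x => max 0 (l i x + c i)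
  have hgφ : ∀ n x, partialSups g n x ≤ φ x := fun n =>
    partialSups_le g n φ fun i _ x => max_le (h0 x) (hle i x)
  refine ⟨partialSups g, (partialSups g).monotone, fun x => tendsto_order.2
    ⟨fun a ha => ?_, fun a ha => .of_forall fun n => (hgφ n x).trans_lt ha⟩, fun n => ?_⟩
  · rw [← hsup, iSup_apply] at ha
    obtain ⟨i, hi⟩ := exists_lt_of_lt_ciSup ha
    filter_upwards [eventually_ge_atTop i] with n hn
    exact (hi.trans_le (le_max_right _ _)).trans_le (le_partialSups_of_le g hn x)
  · have hg : ∀ i, ConvexOn ℝ univ (g i) ∧ (∀ x, 0 ≤ g i x) ∧ ∃ K, ∀ x, g i x ≤ K * (1 + ‖x‖) := by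
      refine fun i => ⟨(convexOn_const 0 convex_univ).sup (convexOn_clm_add_const (l i) (c i)),
        fun x => le_max_left _ _, ‖l i‖ + |c i|, fun x => max_le (by positivity) ?_⟩
      nlinarith [(le_abs_self _).trans ((l i).le_opNorm x), le_abs_self (c i),
        mul_nonneg (abs_nonneg (c i)) (norm_nonneg x), norm_nonneg (l i)]
    induction n with
    | zero => simpa only [partialSups_zero] using hg 0
    | succ n ih =>
      rw [partialSups_add_one]
      obtain ⟨hconv, hnonneg, K, hK⟩ := ih
      obtain ⟨hconv', -, K', hK'⟩ := hg (n + 1)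
      refine ⟨hconv.sup hconv', fun x => le_sup_of_le_left (hnonneg x), max K K', fun x =>
        sup_le ((hK x).trans ?_) ((hK' x).trans ?_)⟩
      · gcongr
        exact le_max_left K K'
      · gcongr
        exact le_max_right K K'

end ConvexFunctions

/-- The order defined by the integrals of the nonnegative convex functions. Between probability
measures with finite second order moment it is the convex order, and it avoids integrals with
values in `[-∞, ∞]`. -/
def NonnegCxLE {V : Type*} [AddCommMonoid V] [Module ℝ V] [MeasurableSpace V]
    (η ν : Measure V) : Prop :=
  ∀ φ : V → ℝ, ConvexOn ℝ univ φ → (∀ x, 0 ≤ φ x) →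
    ∫⁻ x, ENNReal.ofReal (φ x) ∂η ≤ ∫⁻ x, ENNReal.ofReal (φ x) ∂ν

theorem memLp_id_two_iff_integrable_norm_sq {V : Type*} [NormedAddCommGroup V]
    [MeasurableSpace V] [BorelSpace V] [SecondCountableTopology V] {η : Measure V} :
    MemLp id 2 η ↔ Integrable (fun x => ‖x‖ ^ 2) η :=
  memLp_two_iff_integrable_sq_norm (by fun_prop)

theorem integrable_clm_add_const {V : Type*} [NormedAddCommGroup V] [NormedSpace ℝ V]
    [MeasurableSpace V] {ν : Measure V} [IsFiniteMeasure ν] (hν : Integrable id ν)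
    (L : V →L[ℝ] ℝ) (c : ℝ) : Integrable (fun x => L x + c) ν :=
  (L.integrable_comp hν).add (integrable_const c)

section NormedSpace

variable {V : Type*} [NormedAddCommGroup V] [NormedSpace ℝ V] [FiniteDimensional ℝ V]
  [MeasurableSpace V] [BorelSpace V] {η ν : Measure V} {φ : V → ℝ}

namespace NonnegCxLE

theorem integrable_of_nonneg (h : NonnegCxLE η ν) (hφ : ConvexOn ℝ univ φ) (h0 : ∀ x, 0 ≤ φ x)
    (hν : Integrable φ ν) : Integrable φ η := by
  refine ⟨(continuous_of_convexOn hφ).aestronglyMeasurable, ?_⟩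
  rw [hasFiniteIntegral_iff_ofReal (.of_forall h0)]
  exact (h φ hφ h0).trans_lt hν.lintegral_lt_top

theorem integrable_id (h : NonnegCxLE η ν) (hν : Integrable id ν) : Integrable id η := by
  have hnorm := h.integrable_of_nonneg (convexOn_norm convex_univ) norm_nonneg hν.norm
  exact (integrable_norm_iff (by fun_prop)).1 hnorm

theorem memLp_id_two {V : Type*} [NormedAddCommGroup V] [InnerProductSpace ℝ V]
    [FiniteDimensional ℝ V] [MeasurableSpace V] [BorelSpace V] {η ν : Measure V}
    (h : NonnegCxLE η ν) (hν : MemLp id 2 ν) : MemLp id 2 η := by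
  rw [memLp_id_two_iff_integrable_norm_sq] at hν ⊢
  exact h.integrable_of_nonneg strictConvexOn_norm_sq.convexOn (fun x => sq_nonneg ‖x‖) hν

theorem integrable [IsFiniteMeasure η] [IsFiniteMeasure ν] (h : NonnegCxLE η ν)
    (hν : Integrable id ν) (hφ : ConvexOn ℝ univ φ) (hφν : Integrable φ ν) : Integrable φ η := by
  obtain ⟨L, c, hL⟩ := exists_clm_add_const_le hφ
  have hsub := h.integrable_of_nonneg (hφ.sub (concaveOn_clm_add_const L c))
    (fun x => sub_nonneg.2 (hL x)) (hφν.sub (integrable_clm_add_const hν L c))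
  simpa using hsub.add (integrable_clm_add_const (h.integrable_id hν) L c)

theorem integral_le_of_nonneg (h : NonnegCxLE η ν) (hφ : ConvexOn ℝ univ φ) (h0 : ∀ x, 0 ≤ φ x)
    (hν : Integrable φ ν) : ∫ x, φ x ∂η ≤ ∫ x, φ x ∂ν := by
  rw [integral_eq_lintegral_of_nonneg_ae (.of_forall h0) (h.integrable_of_nonneg hφ h0 hν).1,
    integral_eq_lintegral_of_nonneg_ae (.of_forall h0) hν.1]
  exact ENNReal.toReal_mono hν.lintegral_lt_top.ne (h φ hφ h0)

theorem integral_le [IsProbabilityMeasure η] [IsProbabilityMeasure ν] (h : NonnegCxLE η ν)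
    (hφ : ConvexOn ℝ univ φ) (hη : Integrable φ η) (hν : Integrable φ ν) :
    ∫ x, φ x ∂η ≤ ∫ x, φ x ∂ν := by
  have hcont := continuous_of_convexOn hφ
  have hbound : ∀ (n : ℕ) x, ‖max (φ x) (-n)‖ ≤ ‖φ x‖ := fun n x => abs_le.2
    ⟨le_max_of_le_left (neg_abs_le _), max_le (le_abs_self _)
      ((neg_nonpos.2 n.cast_nonneg).trans (abs_nonneg _))⟩
  have hlim : ∀ {ρ : Measure V}, Integrable φ ρ →
      Tendsto (fun n : ℕ => ∫ x, max (φ x) (-n) ∂ρ) atTop (𝓝 (∫ x, φ x ∂ρ)) := fun hρ => by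
    refine tendsto_integral_of_dominated_convergence (fun x => ‖φ x‖)
      (fun n => by fun_prop) hρ.norm (fun n => .of_forall (hbound n)) (.of_forall fun x => ?_)
    refine tendsto_const_nhds.congr' ?_
    filter_upwards [eventually_ge_atTop ⌈-φ x⌉₊] with n hn
    exact (max_eq_left (by linarith [Nat.ceil_le.1 hn])).symm
  have hint : ∀ {ρ : Measure V}, Integrable φ ρ → ∀ n : ℕ,
      Integrable (fun x => max (φ x) (-n)) ρ := fun hρ n =>
    hρ.mono (by fun_prop) (.of_forall (hbound n))
  refine le_of_tendsto_of_tendsto' (hlim hη) (hlim hν) fun n => ?_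
  have hn := h.integral_le_of_nonneg (φ := fun x => max (φ x) (-n) + n)
    ((hφ.sup (convexOn_const _ convex_univ)).add_const _)
    (fun x => by linarith [le_max_right (φ x) (-n)]) ((hint hν n).add (integrable_const _))
  rw [integral_add (hint hη n) (integrable_const _),
    integral_add (hint hν n) (integrable_const _)] at hn
  simpa using hn

theorem integral_clm_add_const_eq [IsProbabilityMeasure η] [IsProbabilityMeasure ν]
    (h : NonnegCxLE η ν) (hν : Integrable id ν) (L : V →L[ℝ] ℝ) (c : ℝ) :
    ∫ x, (L x + c) ∂η = ∫ x, (L x + c) ∂ν := by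
  have hle : ∀ (L : V →L[ℝ] ℝ) (c : ℝ), ∫ x, (L x + c) ∂η ≤ ∫ x, (L x + c) ∂ν := fun L c =>
    h.integral_le (convexOn_clm_add_const L c) (integrable_clm_add_const (h.integrable_id hν) L c)
      (integrable_clm_add_const hν L c)
  refine le_antisymm (hle L c) (neg_le_neg_iff.1 ?_)
  simpa [← integral_neg, add_comm] using hle (-L) (-c)

end NonnegCxLE

end NormedSpace

section StrictlyConvexTestFunctions

variable {V : Type*} [NormedAddCommGroup V] [InnerProductSpace ℝ V] [FiniteDimensional ℝ V]
  [MeasurableSpace V] [BorelSpace V] {η ν : Measure V}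

theorem lintegral_le_of_strictConvexOn_of_linearGrowth (hν : MemLp id 2 ν)
    (h : ∀ φ : V → ℝ, StrictConvexOn ℝ univ φ → (∀ x, 0 ≤ φ x) →
      (∃ K, ∀ x, φ x ≤ K * (1 + ‖x‖ ^ 2)) →
      ∫⁻ x, ENNReal.ofReal (φ x) ∂η ≤ ∫⁻ x, ENNReal.ofReal (φ x) ∂ν)
    {f : V → ℝ} (hf : ConvexOn ℝ univ f) (h0 : ∀ x, 0 ≤ f x) {K : ℝ}
    (hK : ∀ x, f x ≤ K * (1 + ‖x‖)) :
    ∫⁻ x, ENNReal.ofReal (f x) ∂η ≤ ∫⁻ x, ENNReal.ofReal (f x) ∂ν := by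
  have hcont := continuous_of_convexOn hf
  have hle : ∀ ε > 0, ∫⁻ x, ENNReal.ofReal (f x) ∂η ≤ ∫⁻ x, ENNReal.ofReal (f x) ∂ν +
      ENNReal.ofReal ε * ∫⁻ x, ENNReal.ofReal (‖x‖ ^ 2) ∂ν := by
    intro ε hε
    calc ∫⁻ x, ENNReal.ofReal (f x) ∂η
        ≤ ∫⁻ x, ENNReal.ofReal (f x + ε * ‖x‖ ^ 2) ∂η :=
          lintegral_mono fun x => ENNReal.ofReal_le_ofReal (by nlinarith [sq_nonneg ‖x‖])
      _ ≤ ∫⁻ x, ENNReal.ofReal (f x + ε * ‖x‖ ^ 2) ∂ν := by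
          refine h _ (strictConvexOn_add_const_mul_norm_sq hf hε)
            (fun x => add_nonneg (h0 x) (by positivity)) ⟨2 * |K| + ε, fun x => ?_⟩
          have hxK := (hK x).trans (mul_le_mul_of_nonneg_right (le_abs_self K) (by positivity))
          nlinarith [mul_nonneg (abs_nonneg K) (sq_nonneg (‖x‖ - 1)), abs_nonneg K,
            mul_nonneg (abs_nonneg K) (sq_nonneg ‖x‖)]
      _ = _ := by
          simp_rw [ENNReal.ofReal_add (h0 _) (mul_nonneg hε.le (sq_nonneg _)),
            ENNReal.ofReal_mul hε.le]
          rw [lintegral_add_left (by fun_prop), lintegral_const_mul _ (by fun_prop)]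
  have hfin : ∫⁻ x, ENNReal.ofReal (‖x‖ ^ 2) ∂ν ≠ ∞ :=
    (memLp_id_two_iff_integrable_norm_sq.1 hν).lintegral_lt_top.ne
  have hzero : Tendsto ENNReal.ofReal (𝓝[>] 0) (𝓝 0) :=
    (ENNReal.continuous_ofReal.tendsto' 0 0 ENNReal.ofReal_zero).mono_left nhdsWithin_le_nhds
  have hadd := tendsto_const_nhds (x := ∫⁻ x, ENNReal.ofReal (f x) ∂ν).add
    (ENNReal.Tendsto.mul_const hzero (.inr hfin))
  rw [zero_mul, add_zero] at hadd
  exact ge_of_tendsto hadd (eventually_mem_nhdsWithin.mono hle)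

theorem nonnegCxLE_of_strictConvexOn (hν : MemLp id 2 ν)
    (h : ∀ φ : V → ℝ, StrictConvexOn ℝ univ φ → (∀ x, 0 ≤ φ x) →
      (∃ K, ∀ x, φ x ≤ K * (1 + ‖x‖ ^ 2)) →
      ∫⁻ x, ENNReal.ofReal (φ x) ∂η ≤ ∫⁻ x, ENNReal.ofReal (φ x) ∂ν) : NonnegCxLE η ν := by
  intro φ hφ h0
  obtain ⟨f, hmono, hlim, hf⟩ := exists_monotone_linearGrowth_tendsto hφ h0
  have hlim' : ∀ ρ : Measure V, Tendsto (fun n => ∫⁻ x, ENNReal.ofReal (f n x) ∂ρ) atTop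
      (𝓝 (∫⁻ x, ENNReal.ofReal (φ x) ∂ρ)) := fun ρ =>
    lintegral_tendsto_of_tendsto_of_monotone
      (fun n => (continuous_of_convexOn (hf n).1).measurable.ennreal_ofReal.aemeasurable)
      (.of_forall fun x m n hmn => ENNReal.ofReal_le_ofReal (hmono hmn x))
      (.of_forall fun x => ENNReal.tendsto_ofReal (hlim x))
  refine le_of_tendsto_of_tendsto' (hlim' η) (hlim' ν) fun n => ?_
  obtain ⟨hconv, hnonneg, K, hK⟩ := hf n
  exact lintegral_le_of_strictConvexOn_of_linearGrowth hν h hconv hnonneg hK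

end StrictlyConvexTestFunctions

section WeakConvergence

variable {Ω : Type*} [TopologicalSpace Ω] [MeasurableSpace Ω] [OpensMeasurableSpace Ω]
  [HasOuterApproxClosed Ω] {s : ℕ → ProbabilityMeasure Ω} {ρ : ProbabilityMeasure Ω} {f : Ω → ℝ}

theorem lintegral_le_of_tendsto (hs : Tendsto s atTop (𝓝 ρ)) (hf : Continuous f)
    (h0 : ∀ x, 0 ≤ f x) {u : ℕ → ℝ≥0∞} {b : ℝ≥0∞} (hu : Tendsto u atTop (𝓝 b))
    (hle : ∀ n, ∫⁻ x, ENNReal.ofReal (f x) ∂(s n : Measure Ω) ≤ u n) :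
    ∫⁻ x, ENNReal.ofReal (f x) ∂(ρ : Measure Ω) ≤ b :=
  calc ∫⁻ x, ENNReal.ofReal (f x) ∂(ρ : Measure Ω)
      ≤ liminf (fun n => ∫⁻ x, ENNReal.ofReal (f x) ∂(s n : Measure Ω)) atTop :=
        lintegral_le_liminf_lintegral_of_forall_isOpen_measure_le_liminf_measure hf h0
          fun _ hG => ProbabilityMeasure.le_liminf_measure_open_of_tendsto hs hG
    _ ≤ liminf u atTop := liminf_le_liminf (.of_forall hle)
    _ = b := hu.liminf_eq

theorem integrable_and_integral_le_of_tendsto (hs : Tendsto s atTop (𝓝 ρ)) (hf : Continuous f)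
    (h0 : ∀ x, 0 ≤ f x) (hint : ∀ n, Integrable f (s n : Measure Ω)) {u : ℕ → ℝ} {b : ℝ}
    (hu : Tendsto u atTop (𝓝 b)) (hle : ∀ n, ∫ x, f x ∂(s n : Measure Ω) ≤ u n) :
    Integrable f (ρ : Measure Ω) ∧ ∫ x, f x ∂(ρ : Measure Ω) ≤ b := by
  have hb : 0 ≤ b := ge_of_tendsto' hu fun n => (integral_nonneg h0).trans (hle n)
  have hlint : ∫⁻ x, ENNReal.ofReal (f x) ∂(ρ : Measure Ω) ≤ ENNReal.ofReal b := by
    refine lintegral_le_of_tendsto hs hf h0 (ENNReal.tendsto_ofReal hu) fun n => ?_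
    rw [← ofReal_integral_eq_lintegral_ofReal (hint n) (.of_forall h0)]
    exact ENNReal.ofReal_le_ofReal (hle n)
  refine ⟨⟨hf.measurable.aestronglyMeasurable, ?_⟩, ?_⟩
  · rw [hasFiniteIntegral_iff_ofReal (.of_forall h0)]
    exact hlint.trans_lt ENNReal.ofReal_lt_top
  · rw [integral_eq_lintegral_of_nonneg_ae (.of_forall h0) hf.measurable.aestronglyMeasurable]
    exact ENNReal.toReal_le_of_le_ofReal hb hlint

end WeakConvergence

theorem NonnegCxLE.of_tendsto {V : Type*} [NormedAddCommGroup V] [NormedSpace ℝ V]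
    [FiniteDimensional ℝ V] [MeasurableSpace V] [BorelSpace V] {s : ℕ → ProbabilityMeasure V}
    {η : ProbabilityMeasure V} {ν : Measure V} (hs : Tendsto s atTop (𝓝 η))
    (h : ∀ n, NonnegCxLE (s n : Measure V) ν) : NonnegCxLE (η : Measure V) ν := fun φ hφ h0 =>
  lintegral_le_of_tendsto hs (continuous_of_convexOn hφ) h0 tendsto_const_nhds fun n => h n φ hφ h0

theorem isTightMeasureSet_of_integral_norm_sq_le {V : Type*} [NormedAddCommGroup V]
    [ProperSpace V] [MeasurableSpace V] [BorelSpace V] {S : Set (Measure V)} {C : ℝ}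
    (hint : ∀ η ∈ S, MemLp id 2 η) (hle : ∀ η ∈ S, ∫ x, ‖x‖ ^ 2 ∂η ≤ C) :
    IsTightMeasureSet S := by
  have hlim : Tendsto (fun r : ℝ => ENNReal.ofReal (C / r ^ 2)) atTop (𝓝 0) := by
    rw [← ENNReal.ofReal_zero]
    exact ENNReal.tendsto_ofReal (tendsto_const_nhds.div_atTop (tendsto_pow_atTop two_ne_zero))
  refine isTightMeasureSet_of_tendsto_measure_norm_gt (tendsto_of_tendsto_of_tendsto_of_le_of_le'
    tendsto_const_nhds hlim (.of_forall fun _ => zero_le) ?_)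
  filter_upwards [eventually_gt_atTop 0] with r hr
  refine iSup₂_le fun η hη => ?_
  have hr2 : 0 < r ^ 2 := by positivity
  calc η {x | r < ‖x‖}
      ≤ η {x | ENNReal.ofReal (r ^ 2) ≤ ENNReal.ofReal (‖x‖ ^ 2)} :=
        measure_mono fun x (hx : r < ‖x‖) => ENNReal.ofReal_le_ofReal (by gcongr)
    _ ≤ (∫⁻ x, ENNReal.ofReal (‖x‖ ^ 2) ∂η) / ENNReal.ofReal (r ^ 2) :=
        meas_ge_le_lintegral_div (by fun_prop) (ENNReal.ofReal_pos.2 hr2).ne' ENNReal.ofReal_ne_top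
    _ ≤ ENNReal.ofReal (C / r ^ 2) := by
        rw [ENNReal.ofReal_div_of_pos hr2, ← ofReal_integral_eq_lintegral_ofReal
          (memLp_id_two_iff_integrable_norm_sq.1 (hint η hη)) (.of_forall fun x => sq_nonneg ‖x‖)]
        gcongr
        exact hle η hη

theorem isProbabilityMeasure_of_fst_eq {α β : Type*} [MeasurableSpace α] [MeasurableSpace β]
    {μ : Measure α} [IsProbabilityMeasure μ] {π : Measure (α × β)} (h : π.fst = μ) :
    IsProbabilityMeasure π :=
  ⟨by rw [← Measure.fst_univ, h, measure_univ]⟩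

theorem integral_comp_fst {α β F : Type*} [MeasurableSpace α] [MeasurableSpace β]
    [NormedAddCommGroup F] [NormedSpace ℝ F] {π : Measure (α × β)} {f : α → F}
    (hf : AEStronglyMeasurable f π.fst) : ∫ p, f p.1 ∂π = ∫ x, f x ∂π.fst :=
  (integral_map measurable_fst.aemeasurable hf).symm

theorem integral_comp_snd {α β F : Type*} [MeasurableSpace α] [MeasurableSpace β]
    [NormedAddCommGroup F] [NormedSpace ℝ F] {π : Measure (α × β)} {f : β → F}
    (hf : AEStronglyMeasurable f π.snd) : ∫ p, f p.2 ∂π = ∫ y, f y ∂π.snd :=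
  (integral_map measurable_snd.aemeasurable hf).symm

/-- The correlation `∫ ⟨x, y⟩ π(dx, dy)`. Maximizing it over the couplings of two given measures
amounts to minimizing the quadratic transport cost. -/
noncomputable def corr {V : Type*} [NormedAddCommGroup V] [InnerProductSpace ℝ V]
    [MeasurableSpace V] (π : Measure (V × V)) : ℝ :=
  ∫ p, inner ℝ p.1 p.2 ∂π

section Correlation

variable {V : Type*} [NormedAddCommGroup V] [InnerProductSpace ℝ V] [SecondCountableTopology V]
  [MeasurableSpace V] [BorelSpace V] {π : Measure (V × V)}

theorem corr_map_swap (π : Measure (V × V)) : corr (π.map Prod.swap) = corr π := by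
  rw [corr, integral_map measurable_swap.aemeasurable (by fun_prop)]
  simp only [Prod.fst_swap, Prod.snd_swap, real_inner_comm, corr]

theorem integrable_inner_of_memLp (h₁ : MemLp id 2 π.fst) (h₂ : MemLp id 2 π.snd) :
    Integrable (fun p => inner ℝ p.1 p.2) π := by
  have h₁' := h₁.norm.comp_measurePreserving (measurable_fst.measurePreserving π)
  have h₂' := h₂.norm.comp_measurePreserving (measurable_snd.measurePreserving π)
  exact (h₁'.integrable_mul h₂').mono' (by fun_prop) (.of_forall fun p => norm_inner_le_norm _ _)

theorem integrable_norm_smul_sub_smul_sq (h₁ : MemLp id 2 π.fst) (h₂ : MemLp id 2 π.snd)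
    (a b : ℝ) : Integrable (fun p => ‖a • p.1 - b • p.2‖ ^ 2) π := by
  have h₁' := h₁.comp_measurePreserving (measurable_fst.measurePreserving π)
  have h₂' := h₂.comp_measurePreserving (measurable_snd.measurePreserving π)
  exact (memLp_two_iff_integrable_sq_norm (by fun_prop)).1
    ((h₁'.const_smul a).sub (h₂'.const_smul b))

theorem integral_norm_smul_sub_smul_sq (h₁ : MemLp id 2 π.fst) (h₂ : MemLp id 2 π.snd)
    (a b : ℝ) : ∫ p, ‖a • p.1 - b • p.2‖ ^ 2 ∂π =
      a ^ 2 * ∫ x, ‖x‖ ^ 2 ∂π.fst + b ^ 2 * ∫ y, ‖y‖ ^ 2 ∂π.snd - 2 * a * b * corr π := by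
  have hexpand : ∀ p : V × V, ‖a • p.1 - b • p.2‖ ^ 2 =
      a ^ 2 * ‖p.1‖ ^ 2 + b ^ 2 * ‖p.2‖ ^ 2 - 2 * a * b * inner ℝ p.1 p.2 := fun p => by
    rw [norm_sub_sq_real, norm_smul, norm_smul, real_inner_smul_left, real_inner_smul_right,
      mul_pow, mul_pow, Real.norm_eq_abs, Real.norm_eq_abs, sq_abs, sq_abs]
    ring
  have hx : Integrable (fun p => ‖p.1‖ ^ 2) π :=
    (memLp_id_two_iff_integrable_norm_sq.1 h₁).comp_measurable measurable_fst
  have hy : Integrable (fun p => ‖p.2‖ ^ 2) π :=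
    (memLp_id_two_iff_integrable_norm_sq.1 h₂).comp_measurable measurable_snd
  have hxy : Integrable (fun p => a ^ 2 * ‖p.1‖ ^ 2 + b ^ 2 * ‖p.2‖ ^ 2) π :=
    (hx.const_mul _).add (hy.const_mul _)
  simp_rw [hexpand]
  rw [integral_sub hxy ((integrable_inner_of_memLp h₁ h₂).const_mul _),
    integral_add (hx.const_mul _) (hy.const_mul _)]
  simp only [integral_const_mul]
  rw [integral_comp_fst (f := fun x => ‖x‖ ^ 2) (by fun_prop),
    integral_comp_snd (f := fun y => ‖y‖ ^ 2) (by fun_prop), corr]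

theorem two_mul_corr_le (h₁ : MemLp id 2 π.fst) (h₂ : MemLp id 2 π.snd) :
    2 * corr π ≤ ∫ x, ‖x‖ ^ 2 ∂π.fst + ∫ y, ‖y‖ ^ 2 ∂π.snd := by
  have hnonneg : 0 ≤ ∫ p, ‖(1 : ℝ) • p.1 - (1 : ℝ) • p.2‖ ^ 2 ∂π :=
    integral_nonneg fun p => sq_nonneg ‖_‖
  rw [integral_norm_smul_sub_smul_sq h₁ h₂] at hnonneg
  linarith

/-- Completing the square, `2 ⟨x, y⟩ = t⁻² |x|² + t² |y|² - |t⁻¹ x - t y|²`: the integral of the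
first term is constant, that of the second is at most `t² C`, and that of the last is lower
semicontinuous. -/
theorem le_corr_of_tendsto {μ : Measure V} (hμ : MemLp id 2 μ)
    {s : ℕ → ProbabilityMeasure (V × V)} {ρ : ProbabilityMeasure (V × V)}
    (hs : Tendsto s atTop (𝓝 ρ)) (hfst : ∀ n, (s n : Measure (V × V)).fst = μ)
    (hρ : (ρ : Measure (V × V)).fst = μ) (hint : ∀ n, MemLp id 2 (s n : Measure (V × V)).snd)
    (hρint : MemLp id 2 (ρ : Measure (V × V)).snd) {C : ℝ}
    (hC : ∀ n, ∫ y, ‖y‖ ^ 2 ∂(s n : Measure (V × V)).snd ≤ C) {u : ℕ → ℝ} {c : ℝ}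
    (hu : Tendsto u atTop (𝓝 c)) (hle : ∀ n, u n ≤ corr (s n : Measure (V × V))) :
    c ≤ corr (ρ : Measure (V × V)) := by
  have hsq : ∀ t > 0, c ≤ corr (ρ : Measure (V × V)) + t ^ 2 * (C / 2) := by
    intro t ht
    have hexpand : ∀ {π : Measure (V × V)}, π.fst = μ → MemLp id 2 π.snd →
        ∫ p, ‖t⁻¹ • p.1 - t • p.2‖ ^ 2 ∂π =
          t⁻¹ ^ 2 * ∫ x, ‖x‖ ^ 2 ∂μ + t ^ 2 * ∫ y, ‖y‖ ^ 2 ∂π.snd - 2 * corr π := by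
      rintro π rfl hπ
      rw [integral_norm_smul_sub_smul_sq hμ hπ, mul_assoc 2, inv_mul_cancel₀ ht.ne', mul_one]
    have hbound : ∀ n, ∫ p, ‖t⁻¹ • p.1 - t • p.2‖ ^ 2 ∂(s n : Measure (V × V)) ≤
        t⁻¹ ^ 2 * ∫ x, ‖x‖ ^ 2 ∂μ + t ^ 2 * C - 2 * u n := fun n => by
      rw [hexpand (hfst n) (hint n)]
      nlinarith [mul_le_mul_of_nonneg_left (hC n) (sq_nonneg t), hle n]
    have hlim := (integrable_and_integral_le_of_tendsto hs (by fun_prop) (fun p => sq_nonneg ‖_‖)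
      (fun n => integrable_norm_smul_sub_smul_sq ((hfst n).symm ▸ hμ) (hint n) _ _)
      (tendsto_const_nhds.sub (hu.const_mul 2)) hbound).2
    rw [hexpand hρ hρint] at hlim
    have hnonneg : 0 ≤ ∫ y, ‖y‖ ^ 2 ∂(ρ : Measure (V × V)).snd :=
      integral_nonneg fun y => sq_nonneg ‖y‖
    nlinarith [mul_nonneg (sq_nonneg t) hnonneg]
  have hzero : Tendsto (fun t : ℝ => corr (ρ : Measure (V × V)) + t ^ 2 * (C / 2)) (𝓝[>] 0)
      (𝓝 (corr (ρ : Measure (V × V)))) :=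
    (Continuous.tendsto' (by fun_prop) 0 _ (by simp)).mono_left nhdsWithin_le_nhds
  exact ge_of_tendsto hzero (eventually_mem_nhdsWithin.mono hsq)

end Correlation

section Compactness

variable {V : Type*} [NormedAddCommGroup V] [InnerProductSpace ℝ V] [FiniteDimensional ℝ V]
  [MeasurableSpace V] [BorelSpace V] {μ : Measure V}

theorem exists_subseq_tendsto_le_corr (hμ : MemLp id 2 μ) {s : ℕ → ProbabilityMeasure (V × V)}
    (hfst : ∀ n, (s n : Measure (V × V)).fst = μ)
    (hint : ∀ n, MemLp id 2 (s n : Measure (V × V)).snd) {C : ℝ}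
    (hC : ∀ n, ∫ y, ‖y‖ ^ 2 ∂(s n : Measure (V × V)).snd ≤ C) {u : ℕ → ℝ} {c : ℝ}
    (hu : Tendsto u atTop (𝓝 c)) (hle : ∀ n, u n ≤ corr (s n : Measure (V × V))) :
    ∃ (ρ : ProbabilityMeasure (V × V)) (k : ℕ → ℕ), StrictMono k ∧ Tendsto (s ∘ k) atTop (𝓝 ρ) ∧
      (ρ : Measure (V × V)).fst = μ ∧ c ≤ corr (ρ : Measure (V × V)) := by
  have htight : IsTightMeasureSet {((π : ProbabilityMeasure (V × V)) : Measure (V × V)) |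
      π ∈ range s} := by
    refine IsTightMeasureSet.prodMk
      (isTightMeasureSet_of_integral_norm_sq_le (C := ∫ x, ‖x‖ ^ 2 ∂μ) ?_ ?_)
      (isTightMeasureSet_of_integral_norm_sq_le (C := C) ?_ ?_) <;>
    rintro _ ⟨_, ⟨_, ⟨n, rfl⟩, rfl⟩, rfl⟩
    exacts [(hfst n).symm ▸ hμ, (congrArg (fun m => ∫ x, ‖x‖ ^ 2 ∂m) (hfst n)).le, hint n, hC n]
  obtain ⟨ρ, -, k, hk, hlim⟩ := (isCompact_closure_of_isTightMeasureSet htight).isSeqCompact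
    (x := s) fun n => subset_closure (mem_range_self n)
  have hρfst : (ρ : Measure (V × V)).fst = μ := by
    have hmap := ProbabilityMeasure.tendsto_map_of_tendsto_of_continuous _ _ hlim continuous_fst
    have hconst : ∀ n, ((s ∘ k) n).map continuous_fst.aemeasurable =
        (s 0).map continuous_fst.aemeasurable := fun n =>
      ProbabilityMeasure.toMeasure_injective ((hfst (k n)).trans (hfst 0).symm)
    simp only [hconst] at hmap
    have heq := tendsto_nhds_unique hmap tendsto_const_nhds
    exact (congrArg ProbabilityMeasure.toMeasure heq).trans (hfst 0)
  have hρsnd : MemLp id 2 (ρ : Measure (V × V)).snd := by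
    have hmap := ProbabilityMeasure.tendsto_map_of_tendsto_of_continuous _ _ hlim continuous_snd
    exact memLp_id_two_iff_integrable_norm_sq.2 (integrable_and_integral_le_of_tendsto hmap
      (by fun_prop) (fun y => sq_nonneg ‖y‖)
      (fun n => memLp_id_two_iff_integrable_norm_sq.1 (hint (k n))) tendsto_const_nhds
      fun n => hC (k n)).1
  exact ⟨ρ, k, hk, hlim, hρfst, le_corr_of_tendsto hμ hlim (fun n => hfst (k n)) hρfst
    (fun n => hint (k n)) hρsnd (fun n => hC (k n)) (hu.comp hk.tendsto_atTop)
    fun n => hle (k n)⟩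

theorem exists_le_corr_of_tendsto_snd (hμ : MemLp id 2 μ) {m : ℕ → ProbabilityMeasure V}
    {m₀ : ProbabilityMeasure V} (hm : Tendsto m atTop (𝓝 m₀))
    (hint : ∀ n, MemLp id 2 (m n : Measure V)) {C : ℝ}
    (hC : ∀ n, ∫ y, ‖y‖ ^ 2 ∂(m n : Measure V) ≤ C) {s : ℕ → ProbabilityMeasure (V × V)}
    (hfst : ∀ n, (s n : Measure (V × V)).fst = μ)
    (hsnd : ∀ n, (s n : Measure (V × V)).snd = m n) {u : ℕ → ℝ} {c : ℝ} (hu : Tendsto u atTop (𝓝 c))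
    (hle : ∀ n, u n ≤ corr (s n : Measure (V × V))) :
    ∃ ρ : Measure (V × V), ρ.fst = μ ∧ ρ.snd = m₀ ∧ c ≤ corr ρ := by
  simp only [← hsnd] at hint hC
  obtain ⟨ρ, k, hk, hlim, hρfst, hρ⟩ := exists_subseq_tendsto_le_corr hμ hfst hint hC hu hle
  have hmap := ProbabilityMeasure.tendsto_map_of_tendsto_of_continuous _ _ hlim continuous_snd
  have heq := tendsto_nhds_unique hmap ((hm.comp hk.tendsto_atTop).congr fun n =>
    ProbabilityMeasure.toMeasure_injective (hsnd (k n)).symm)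
  exact ⟨ρ, hρfst, congrArg ProbabilityMeasure.toMeasure heq, hρ⟩

theorem exists_corr_max [IsProbabilityMeasure μ] (hμ : MemLp id 2 μ) {ν : Measure V}
    [IsProbabilityMeasure ν] (hν : MemLp id 2 ν) :
    ∃ π : Measure (V × V), (π.fst = μ ∧ π.snd = ν) ∧
      ∀ π' : Measure (V × V), π'.fst = μ → π'.snd = ν → corr π' ≤ corr π := by
  let S : Set ℝ := corr '' {π : Measure (V × V) | π.fst = μ ∧ π.snd = ν}
  have hne : S.Nonempty := ⟨_, μ.prod ν, ⟨Measure.fst_prod, Measure.snd_prod⟩, rfl⟩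
  have hbdd : BddAbove S := by
    refine ⟨(∫ x, ‖x‖ ^ 2 ∂μ + ∫ y, ‖y‖ ^ 2 ∂ν) / 2, ?_⟩
    rintro - ⟨π, ⟨rfl, rfl⟩, rfl⟩
    linarith [two_mul_corr_le hμ hν]
  obtain ⟨u, -, hu, hmem⟩ := exists_seq_tendsto_sSup hne hbdd
  choose π hπ hcorr using hmem
  let s : ℕ → ProbabilityMeasure (V × V) := fun n =>
    ⟨π n, isProbabilityMeasure_of_fst_eq (hπ n).1⟩
  obtain ⟨ρ, hρfst, hρsnd, hle⟩ := exists_le_corr_of_tendsto_snd hμ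
    (m := fun _ => ⟨ν, inferInstance⟩) tendsto_const_nhds (fun _ => hν) (fun _ => le_rfl)
    (s := s) (fun n => (hπ n).1) (fun n => (hπ n).2) hu fun n => (hcorr n).ge
  exact ⟨ρ, ⟨hρfst, hρsnd⟩, fun π' h₁ h₂ => (le_csSup hbdd ⟨π', ⟨h₁, h₂⟩, rfl⟩).trans hle⟩

end Compactness

theorem exists_measurable_argmax {ι α : Type*} [Finite ι] [Nonempty ι] [MeasurableSpace ι]
    [MeasurableSpace α] {g : ι → α → ℝ} (hg : ∀ i, Measurable (g i)) :
    ∃ A : α → ι, Measurable A ∧ ∀ y i, g i y ≤ g (A y) y := by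
  classical
  cases nonempty_fintype ι
  suffices ∀ s : Finset ι, s.Nonempty → ∃ A : α → ι, Measurable A ∧
      (Measurable fun y => g (A y) y) ∧ ∀ y, ∀ i ∈ s, g i y ≤ g (A y) y by
    obtain ⟨A, hA, -, hmax⟩ := this Finset.univ Finset.univ_nonempty
    exact ⟨A, hA, fun y i => hmax y i (Finset.mem_univ i)⟩
  intro s hs
  induction hs using Finset.Nonempty.cons_induction with
  | singleton i => exact ⟨fun _ => i, measurable_const, hg i, by simp⟩
  | cons j s _ _ ih =>
    obtain ⟨A, hA, hgA, hmax⟩ := ih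
    have hset : MeasurableSet {y | g (A y) y ≤ g j y} := measurableSet_le hgA (hg j)
    refine ⟨fun y => if g (A y) y ≤ g j y then j else A y, measurable_const.ite hset hA, ?_,
      fun y => ?_⟩
    · have hval : (fun y => g (if g (A y) y ≤ g j y then j else A y) y) =
          fun y => max (g (A y) y) (g j y) := by
        ext y
        split_ifs with hle
        · exact (max_eq_right hle).symm
        · exact (max_eq_left (not_le.1 hle).le).symm
      exact hval ▸ hgA.max (hg j)
    · simp only [Finset.mem_cons, forall_eq_or_imp]
      split_ifs with hle
      · exact ⟨le_rfl, fun i hi => (hmax y i hi).trans hle⟩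
      · exact ⟨(not_le.1 hle).le, hmax y⟩

theorem convexOn_argmax {V ι : Type*} [AddCommMonoid V] [Module ℝ V] {g : ι → V → ℝ} {A : V → ι}
    (hg : ∀ i, ConvexOn ℝ univ (g i)) (hA : ∀ y i, g i y ≤ g (A y) y) :
    ConvexOn ℝ univ fun y => g (A y) y :=
  ⟨convex_univ, fun x _ y _ _ _ ha hb hab => ((hg _).2 trivial trivial ha hb hab).trans
    (add_le_add (smul_le_smul_of_nonneg_left (hA x _) ha)
      (smul_le_smul_of_nonneg_left (hA y _) hb))⟩

theorem convex_integral_image {α β W : Type*} [MeasurableSpace α] [MeasurableSpace β]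
    [NormedAddCommGroup W] [NormedSpace ℝ W] {ν : Measure α} {f : α × β → W}
    (hf : ∀ ρ : Measure (α × β), ρ.fst = ν → Integrable f ρ) :
    Convex ℝ ((fun ρ => ∫ p, f p ∂ρ) '' {ρ : Measure (α × β) | ρ.fst = ν}) := by
  rintro - ⟨ρ, hρ, rfl⟩ - ⟨ρ', hρ', rfl⟩ a b ha hb hab
  lift a to NNReal using ha
  lift b to NNReal using hb
  have hab' : a + b = 1 := by exact_mod_cast hab
  refine ⟨a • ρ + b • ρ', ?_, ?_⟩
  · rw [mem_ofPred_eq, Measure.fst_add, Measure.fst, Measure.fst, Measure.map_smul,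
      Measure.map_smul, ← Measure.fst, ← Measure.fst, hρ, hρ', ← add_smul, hab', one_smul]
  · dsimp only
    rw [integral_add_measure ((hf ρ hρ).smul_measure_nnreal) ((hf ρ' hρ').smul_measure_nnreal),
      integral_smul_nnreal_measure, integral_smul_nnreal_measure]
    rfl

theorem integrable_semidiscrete {ι V W : Type*} [Finite ι] [MeasurableSpace ι]
    [DiscreteMeasurableSpace ι] [NormedAddCommGroup V] [NormedSpace ℝ V] [MeasurableSpace V]
    [NormedAddCommGroup W] [NormedSpace ℝ W] {π : Measure (V × ι)}
    [IsFiniteMeasure π] (hπ : Integrable id π.fst) (w : ι → W) (L : ι → V →L[ℝ] W) :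
    Integrable (fun p => w p.2 + L p.2 p.1) π := by
  classical
  cases nonempty_fintype ι
  have hsum : (fun p : V × ι => w p.2 + L p.2 p.1) =
      fun p => ∑ i, (Prod.snd ⁻¹' {i}).indicator (fun q : V × ι => w i + L i q.1) p := by
    ext p
    simp [Set.indicator_apply]
  rw [hsum]
  exact integrable_finsetSum _ fun i _ => ((integrable_const (w i)).add
    ((L i).integrable_comp (hπ.comp_measurable measurable_fst))).indicator
      (measurable_snd (measurableSet_singleton i))

/-- Otherwise a continuous linear form `f` strictly separates the two sides; moving the mass of `ν`
at `y` to an index `i` that maximizes `f (w i + L i y)` and comparing the integrals of the maximum,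
which is convex in `y`, contradicts the order of `π.fst` and `ν`. -/
theorem NonnegCxLE.integral_mem_closure {ι V W : Type*} [Finite ι] [MeasurableSpace ι]
    [DiscreteMeasurableSpace ι] [NormedAddCommGroup V] [NormedSpace ℝ V] [FiniteDimensional ℝ V]
    [MeasurableSpace V] [BorelSpace V] [NormedAddCommGroup W] [NormedSpace ℝ W] [CompleteSpace W]
    {ν : Measure V} [IsProbabilityMeasure ν] (hν : Integrable id ν) {π : Measure (V × ι)}
    [IsProbabilityMeasure π] (h : NonnegCxLE π.fst ν) (w : ι → W) (L : ι → V →L[ℝ] W) :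
    ∫ p, (w p.2 + L p.2 p.1) ∂π ∈ closure
      ((fun ρ => ∫ p, (w p.2 + L p.2 p.1) ∂ρ) '' {ρ : Measure (V × ι) | ρ.fst = ν}) := by
  have hint : ∀ ρ : Measure (V × ι), ρ.fst = ν → Integrable (fun p => w p.2 + L p.2 p.1) ρ := by
    intro ρ hρ
    have := isProbabilityMeasure_of_fst_eq hρ
    exact integrable_semidiscrete (hρ.symm ▸ hν) w L
  by_contra hnot
  obtain ⟨f, u, hlt, hgt⟩ := geometric_hahn_banach_closed_point
    (convex_integral_image hint).closure isClosed_closure hnot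
  let g : ι → V → ℝ := fun i y => f (w i + L i y)
  have hconv : ∀ i, ConvexOn ℝ univ (g i) := fun i => by
    simpa [g, add_comm] using convexOn_clm_add_const (f.comp (L i)) (f (w i))
  have : Nonempty ι := π.nonempty_of_neZero.map Prod.snd
  obtain ⟨A, hA, hmax⟩ := exists_measurable_argmax (g := g) fun i => by fun_prop
  have hgraph : Measurable fun y => (y, A y) := measurable_id.prodMk hA
  have hρ : (ν.map fun y => (y, A y)).fst = ν := by
    rw [Measure.fst_map_prodMk hA, Measure.map_id']
  have hgπ : Integrable (fun p => g p.2 p.1) π :=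
    f.integrable_comp (integrable_semidiscrete (h.integrable_id hν) w L)
  have hgρ := f.integrable_comp (hint _ hρ)
  have hGν : Integrable (fun y => g (A y) y) ν := hgρ.comp_measurable hgraph
  have hGπ := h.integrable hν (convexOn_argmax hconv hmax) hGν
  refine (hgt.trans_le ?_).not_gt (hlt _ (subset_closure ⟨_, hρ, rfl⟩))
  calc f (∫ p, (w p.2 + L p.2 p.1) ∂π)
      = ∫ p, g p.2 p.1 ∂π :=
        (f.integral_comp_comm (integrable_semidiscrete (h.integrable_id hν) w L)).symm
    _ ≤ ∫ p, g (A p.1) p.1 ∂π :=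
        integral_mono hgπ (hGπ.comp_measurable measurable_fst) fun p => hmax p.1 p.2
    _ = ∫ y, g (A y) y ∂π.fst := integral_comp_fst hGπ.1
    _ ≤ ∫ y, g (A y) y ∂ν := h.integral_le (convexOn_argmax hconv hmax) hGπ hGν
    _ = ∫ p, g p.2 p.1 ∂(ν.map fun y => (y, A y)) :=
        (integral_map hgraph.aemeasurable hgρ.1).symm
    _ = f (∫ p, (w p.2 + L p.2 p.1) ∂(ν.map fun y => (y, A y))) :=
        f.integral_comp_comm (hint _ hρ)

theorem NonnegCxLE.exists_seq_integral_tendsto {ι V W : Type*} [Finite ι] [MeasurableSpace ι]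
    [DiscreteMeasurableSpace ι] [NormedAddCommGroup V] [NormedSpace ℝ V] [FiniteDimensional ℝ V]
    [MeasurableSpace V] [BorelSpace V] [NormedAddCommGroup W] [NormedSpace ℝ W] [CompleteSpace W]
    {ν : Measure V} [IsProbabilityMeasure ν] (hν : Integrable id ν) {π : Measure (V × ι)}
    [IsProbabilityMeasure π] (h : NonnegCxLE π.fst ν) (w : ι → W) (L : ι → V →L[ℝ] W) :
    ∃ ρ : ℕ → Measure (V × ι), (∀ n, (ρ n).fst = ν) ∧ ∀ f : W →L[ℝ] ℝ,
      Tendsto (fun n => ∫ p, f (w p.2 + L p.2 p.1) ∂ρ n) atTop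
        (𝓝 (∫ p, f (w p.2 + L p.2 p.1) ∂π)) := by
  obtain ⟨x, hx, hlim⟩ := mem_closure_iff_seq_limit.1 (h.integral_mem_closure hν w L)
  choose ρ hρ hxρ using hx
  refine ⟨ρ, hρ, fun f => ?_⟩
  rw [f.integral_comp_comm (integrable_semidiscrete (h.integrable_id hν) w L)]
  refine ((f.continuous.tendsto _).comp hlim).congr fun n => ?_
  have := isProbabilityMeasure_of_fst_eq (hρ n)
  rw [f.integral_comp_comm (integrable_semidiscrete ((hρ n).symm ▸ hν) w L)]
  exact congrArg f (hxρ n).symm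

theorem NonnegCxLE.exists_seq_tendsto {ι V : Type*} [Finite ι] [MeasurableSpace ι]
    [DiscreteMeasurableSpace ι] [NormedAddCommGroup V] [InnerProductSpace ℝ V]
    [FiniteDimensional ℝ V] [MeasurableSpace V] [BorelSpace V] {ν : Measure V}
    [IsProbabilityMeasure ν] (hν : Integrable id ν) {π : Measure (V × ι)} [IsProbabilityMeasure π]
    (h : NonnegCxLE π.fst ν) (a : ι → V) :
    ∃ ρ : ℕ → Measure (V × ι), (∀ n, (ρ n).fst = ν) ∧
      (∀ i, Tendsto (fun n => (ρ n).snd.real {i}) atTop (𝓝 (π.snd.real {i}))) ∧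
      Tendsto (fun n => ∫ p, inner ℝ p.1 (a p.2) ∂ρ n) atTop
        (𝓝 (∫ p, inner ℝ p.1 (a p.2) ∂π)) := by
  classical
  cases nonempty_fintype ι
  obtain ⟨ρ, hρ, hlim⟩ := h.exists_seq_integral_tendsto (W := (ι → ℝ) × ℝ) hν
    (fun i => (Pi.single i 1, 0))
    fun i => (ContinuousLinearMap.inr ℝ (ι → ℝ) ℝ).comp (innerSL ℝ (a i))
  refine ⟨ρ, hρ, fun i => ?_, ?_⟩
  · have hweight : ∀ π : Measure (V × ι),
        ∫ p, (Pi.single p.2 1 : ι → ℝ) i ∂π = π.snd.real {i} := fun π => by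
      rw [integral_comp_snd (f := fun j => (Pi.single j 1 : ι → ℝ) i)
        Measurable.of_discrete.aestronglyMeasurable, ← integral_indicator_one .of_discrete]
      simp [Pi.single_apply, Set.indicator_apply, eq_comm]
    simpa [hweight] using
      hlim ((ContinuousLinearMap.proj i).comp (ContinuousLinearMap.fst ℝ (ι → ℝ) ℝ))
  · simpa [real_inner_comm] using hlim (ContinuousLinearMap.snd ℝ (ι → ℝ) ℝ)

theorem tendsto_map_of_tendsto_measureReal_singleton {ι X : Type*} [Finite ι] [MeasurableSpace ι]
    [DiscreteMeasurableSpace ι] [TopologicalSpace X] [MeasurableSpace X] [OpensMeasurableSpace X]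
    {m : ℕ → ProbabilityMeasure ι} {m₀ : ProbabilityMeasure ι}
    (h : ∀ i, Tendsto (fun n => (m n : Measure ι).real {i}) atTop (𝓝 ((m₀ : Measure ι).real {i})))
    (a : ι → X) :
    Tendsto (fun n => (m n).map (f := a) Measurable.of_discrete.aemeasurable) atTop
      (𝓝 (m₀.map (f := a) Measurable.of_discrete.aemeasurable)) := by
  cases nonempty_fintype ι
  have hint : ∀ (m : ProbabilityMeasure ι) (f : BoundedContinuousFunction X ℝ),
      ∫ x, f x ∂(m.map (f := a) Measurable.of_discrete.aemeasurable : Measure X) =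
        ∑ i, (m : Measure ι).real {i} * f (a i) := fun m f => by
    rw [ProbabilityMeasure.toMeasure_map, integral_map Measurable.of_discrete.aemeasurable
      f.continuous.measurable.aestronglyMeasurable, integral_fintype .of_finite]
    rfl
  refine ProbabilityMeasure.tendsto_iff_forall_integral_tendsto.2 fun f => ?_
  simp only [hint]
  exact tendsto_finsetSum _ fun i _ => (h i).mul_const _

namespace NonnegCxLE

variable {V : Type*} [NormedAddCommGroup V] [InnerProductSpace ℝ V] [FiniteDimensional ℝ V]
  [MeasurableSpace V] [BorelSpace V] {ν : Measure V} [IsProbabilityMeasure ν]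

theorem exists_le_corr_of_finite {ι : Type*} [Finite ι] [MeasurableSpace ι]
    [DiscreteMeasurableSpace ι] (hν : MemLp id 2 ν) {π : Measure (V × ι)} [IsProbabilityMeasure π]
    (h : NonnegCxLE π.fst ν) (a : ι → V) :
    ∃ ρ : Measure (V × V), ρ.fst = ν ∧ ρ.snd = π.snd.map a ∧
      ∫ p, inner ℝ p.1 (a p.2) ∂π ≤ corr ρ := by
  cases nonempty_fintype ι
  obtain ⟨ρ, hρ, hweight, hinner⟩ := h.exists_seq_tendsto (hν.integrable one_le_two) a
  have hprob : ∀ n, IsProbabilityMeasure (ρ n) := fun n => isProbabilityMeasure_of_fst_eq (hρ n)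
  have ha : Measurable a := .of_discrete
  have hprod : Measurable fun p : V × ι => (p.1, a p.2) := by fun_prop
  let s : ℕ → ProbabilityMeasure (V × V) := fun n =>
    ⟨(ρ n).map fun p => (p.1, a p.2), Measure.isProbabilityMeasure_map (by fun_prop)⟩
  have hsfst : ∀ n, (s n : Measure (V × V)).fst = ν := fun n =>
    (Measure.fst_map_prodMk (by fun_prop)).trans (hρ n)
  have hssnd : ∀ n, (s n : Measure (V × V)).snd = (ρ n).snd.map a := fun n =>
    (Measure.snd_map_prodMk measurable_fst).trans (Measure.map_map ha measurable_snd).symm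
  have hmoment : ∀ n, ∫ y, ‖y‖ ^ 2 ∂((ρ n).snd.map a) ≤ ∑ i, ‖a i‖ ^ 2 := fun n => by
    rw [integral_map ha.aemeasurable (by fun_prop), integral_fintype .of_finite]
    exact Finset.sum_le_sum fun i _ => mul_le_of_le_one_left (sq_nonneg ‖a i‖) measureReal_le_one
  have hmemLp : ∀ n, MemLp id 2 ((ρ n).snd.map a) := fun n =>
    (memLp_map_measure_iff (by fun_prop) ha.aemeasurable).2 .of_discrete
  have hle : ∀ n, ∫ p, inner ℝ p.1 (a p.2) ∂ρ n ≤ corr (s n : Measure (V × V)) := fun n =>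
    (integral_map (f := fun z => inner ℝ z.1 z.2) hprod.aemeasurable (by fun_prop)).ge
  exact exists_le_corr_of_tendsto_snd hν (tendsto_map_of_tendsto_measureReal_singleton
    (m := fun n => ⟨(ρ n).snd, inferInstance⟩) (m₀ := ⟨π.snd, inferInstance⟩) hweight a)
    hmemLp hmoment hsfst hssnd hinner hle

theorem exists_le_corr_of_simpleFunc {α : Type*} [MeasurableSpace α] (hν : MemLp id 2 ν)
    {π : Measure (V × α)} [IsProbabilityMeasure π] (h : NonnegCxLE π.fst ν) (q : SimpleFunc α V) :
    ∃ ρ : Measure (V × V), ρ.fst = ν ∧ ρ.snd = π.snd.map q ∧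
      ∫ p, inner ℝ p.1 (q p.2) ∂π ≤ corr ρ := by
  let r : α → q.range := fun y => ⟨q y, q.mem_range_self y⟩
  have hr : Measurable r := q.measurable.subtype_mk
  have hprod : Measurable fun p : V × α => (p.1, r p.2) := by fun_prop
  have : IsProbabilityMeasure (π.map fun p => (p.1, r p.2)) :=
    Measure.isProbabilityMeasure_map hprod.aemeasurable
  have hfst : (π.map fun p => (p.1, r p.2)).fst = π.fst := Measure.fst_map_prodMk (by fun_prop)
  obtain ⟨ρ, hρfst, hρsnd, hρ⟩ := exists_le_corr_of_finite hν (hfst.symm ▸ h) Subtype.val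
  refine ⟨ρ, hρfst, ?_, ?_⟩
  · rw [hρsnd, Measure.snd_map_prodMk measurable_fst, Measure.snd,
      Measure.map_map measurable_subtype_coe (by fun_prop),
      Measure.map_map q.measurable measurable_snd]
    rfl
  · rwa [integral_map hprod.aemeasurable (by fun_prop)] at hρ

theorem exists_le_corr (hν : MemLp id 2 ν) {π : Measure (V × V)} [IsProbabilityMeasure π]
    (h : NonnegCxLE π.fst ν) (hπ : MemLp id 2 π.snd) :
    ∃ ρ : Measure (V × V), ρ.fst = ν ∧ ρ.snd = π.snd ∧ corr π ≤ corr ρ := by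
  let q : ℕ → SimpleFunc V V := SimpleFunc.approxOn id measurable_id univ 0 trivial
  have hq : ∀ y, Tendsto (fun n => q n y) atTop (𝓝 y) := fun y =>
    SimpleFunc.tendsto_approxOn measurable_id (mem_univ _) (by simp)
  have hnorm : ∀ n y, ‖q n y‖ ≤ 2 * ‖y‖ := fun n y =>
    (SimpleFunc.norm_approxOn_zero_le measurable_id (mem_univ _) y n).trans_eq (two_mul _).symm
  choose ρ hρfst hρsnd hρ using fun n => exists_le_corr_of_simpleFunc hν h (q n)
  have hsq : Integrable (fun y => ‖y‖ ^ 2) π.snd := memLp_id_two_iff_integrable_norm_sq.1 hπ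
  have hmemLp : ∀ n, MemLp id 2 (π.snd.map (q n)) := fun n => by
    rw [memLp_map_measure_iff (by fun_prop) (q n).measurable.aemeasurable]
    exact hπ.of_le_mul (by fun_prop) (.of_forall (hnorm n))
  have hmoment : ∀ n, ∫ y, ‖y‖ ^ 2 ∂(π.snd.map (q n)) ≤ ∫ y, 4 * ‖y‖ ^ 2 ∂π.snd := fun n => by
    rw [integral_map (q n).measurable.aemeasurable (by fun_prop)]
    refine integral_mono_of_nonneg (.of_forall fun y => sq_nonneg ‖q n y‖) (hsq.const_mul 4)
      (.of_forall fun y => ?_)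
    exact (pow_le_pow_left₀ (norm_nonneg _) (hnorm n y) 2).trans_eq (by ring)
  have hcorr : Tendsto (fun n => ∫ p, inner ℝ p.1 (q n p.2) ∂π) atTop (𝓝 (corr π)) := by
    refine tendsto_integral_of_dominated_convergence (fun p => 2 * (‖p.1‖ * ‖p.2‖))
      (fun n => by fun_prop) ?_ (fun n => .of_forall fun p => ?_) (.of_forall fun p => ?_)
    · have h₁ := (h.memLp_id_two hν).norm.comp_measurePreserving
        (measurable_fst.measurePreserving π)
      have h₂ := hπ.norm.comp_measurePreserving (measurable_snd.measurePreserving π)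
      exact (h₁.integrable_mul h₂).const_mul 2
    · calc ‖inner ℝ p.1 (q n p.2)‖ ≤ ‖p.1‖ * ‖q n p.2‖ := norm_inner_le_norm _ _
        _ ≤ ‖p.1‖ * (2 * ‖p.2‖) := by gcongr; exact hnorm n p.2
        _ = 2 * (‖p.1‖ * ‖p.2‖) := by ring
    · exact tendsto_const_nhds.inner (hq p.2)
  have hlim := ((tendstoInMeasure_of_tendsto_ae (fun n => (q n).aestronglyMeasurable)
    (.of_forall hq)).tendstoInDistribution (μ' := π.snd) fun n => (q n).aemeasurable).tendsto
  obtain ⟨ρ', hfst, hsnd, hle⟩ := exists_le_corr_of_tendsto_snd hν hlim hmemLp hmoment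
    (s := fun n => ⟨ρ n, isProbabilityMeasure_of_fst_eq (hρfst n)⟩) hρfst hρsnd hcorr hρ
  exact ⟨ρ', hfst, hsnd.trans Measure.map_id', hle⟩

end NonnegCxLE

open ProbabilityTheory in
theorem exists_gluing {α β β' : Type*} [MeasurableSpace α] [MeasurableSpace β]
    [StandardBorelSpace β] [Nonempty β] [MeasurableSpace β'] [StandardBorelSpace β'] [Nonempty β']
    {π : Measure (α × β)} {π' : Measure (α × β')} [IsFiniteMeasure π] [IsFiniteMeasure π']
    (h : π.fst = π'.fst) : ∃ γ : Measure (α × β × β'),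
      γ.map (fun p => (p.1, p.2.1)) = π ∧ γ.map (fun p => (p.1, p.2.2)) = π' := by
  refine ⟨π.fst ⊗ₘ (π.condKernel ×ₖ π'.condKernel), ?_, ?_⟩
  · calc _ = π.fst ⊗ₘ (π.condKernel ×ₖ π'.condKernel).fst := by
          rw [Kernel.fst_eq, Measure.compProd_map measurable_fst]; rfl
      _ = π := by rw [Kernel.fst_prod, π.disintegrate]
  · calc _ = π.fst ⊗ₘ (π.condKernel ×ₖ π'.condKernel).snd := by
          rw [Kernel.snd_eq, Measure.compProd_map measurable_snd]; rfl
      _ = π' := by rw [Kernel.snd_prod, h, π'.disintegrate]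

theorem corr_map_add_smul {V : Type*} [NormedAddCommGroup V] [InnerProductSpace ℝ V]
    [SecondCountableTopology V] [MeasurableSpace V] [BorelSpace V] {γ : Measure (V × V × V)}
    (h₁ : Integrable (fun p => inner ℝ p.1 p.2) (γ.map fun p => (p.1, p.2.1)))
    (h₂ : Integrable (fun p => inner ℝ p.1 p.2) (γ.map fun p => (p.1, p.2.2))) (a b : ℝ) :
    corr (γ.map fun p => (p.1, a • p.2.1 + b • p.2.2)) =
      a * corr (γ.map fun p => (p.1, p.2.1)) + b * corr (γ.map fun p => (p.1, p.2.2)) := by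
  have h₁' : Integrable (fun p => inner ℝ p.1 p.2.1) γ := h₁.comp_measurable (by fun_prop)
  have h₂' : Integrable (fun p => inner ℝ p.1 p.2.2) γ := h₂.comp_measurable (by fun_prop)
  rw [corr, corr, corr, integral_map (by fun_prop) (by fun_prop),
    integral_map (by fun_prop) (by fun_prop), integral_map (by fun_prop) (by fun_prop)]
  simp only [inner_add_right, real_inner_smul_right]
  rw [integral_add (h₁'.const_mul a) (h₂'.const_mul b), integral_const_mul, integral_const_mul]

section MixedLaws

variable {V : Type*} [NormedAddCommGroup V] [NormedSpace ℝ V] [FiniteDimensional ℝ V]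
  [MeasurableSpace V] [BorelSpace V] {ν : Measure V} {γ : Measure (V × V)} {a b : ℝ}

theorem NonnegCxLE.map_add_smul (h₁ : NonnegCxLE γ.fst ν) (h₂ : NonnegCxLE γ.snd ν) (ha : 0 ≤ a)
    (hb : 0 ≤ b) (hab : a + b = 1) : NonnegCxLE (γ.map fun p => a • p.1 + b • p.2) ν := by
  intro φ hφ h0
  have hmeas : Measurable fun x => ENNReal.ofReal (φ x) :=
    (continuous_of_convexOn hφ).measurable.ennreal_ofReal
  have hfst : Measurable fun p : V × V => ENNReal.ofReal (φ p.1) := hmeas.comp measurable_fst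
  have hsnd : Measurable fun p : V × V => ENNReal.ofReal (φ p.2) := hmeas.comp measurable_snd
  calc ∫⁻ x, ENNReal.ofReal (φ x) ∂(γ.map fun p => a • p.1 + b • p.2)
      = ∫⁻ p, ENNReal.ofReal (φ (a • p.1 + b • p.2)) ∂γ := lintegral_map hmeas (by fun_prop)
    _ ≤ ∫⁻ p, (ENNReal.ofReal a * ENNReal.ofReal (φ p.1) +
          ENNReal.ofReal b * ENNReal.ofReal (φ p.2)) ∂γ := by
        refine lintegral_mono fun p => ?_
        rw [← ENNReal.ofReal_mul ha, ← ENNReal.ofReal_mul hb,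
          ← ENNReal.ofReal_add (mul_nonneg ha (h0 _)) (mul_nonneg hb (h0 _))]
        exact ENNReal.ofReal_le_ofReal (hφ.2 (mem_univ _) (mem_univ _) ha hb hab)
    _ = ENNReal.ofReal a * ∫⁻ x, ENNReal.ofReal (φ x) ∂γ.fst +
          ENNReal.ofReal b * ∫⁻ x, ENNReal.ofReal (φ x) ∂γ.snd := by
        rw [lintegral_add_left (hfst.const_mul _), lintegral_const_mul _ hfst,
          lintegral_const_mul _ hsnd, Measure.fst, Measure.snd,
          lintegral_map hmeas measurable_fst, lintegral_map hmeas measurable_snd]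
    _ ≤ ENNReal.ofReal a * ∫⁻ x, ENNReal.ofReal (φ x) ∂ν +
          ENNReal.ofReal b * ∫⁻ x, ENNReal.ofReal (φ x) ∂ν := by
        gcongr ENNReal.ofReal a * ?_ + ENNReal.ofReal b * ?_
        exacts [h₁ φ hφ h0, h₂ φ hφ h0]
    _ = ∫⁻ x, ENNReal.ofReal (φ x) ∂ν := by
        rw [← add_mul, ← ENNReal.ofReal_add ha hb, hab, ENNReal.ofReal_one, one_mul]

theorem fst_eq_snd_of_strictConvexOn {φ : V → ℝ} (hφ : StrictConvexOn ℝ univ φ)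
    (h₁ : Integrable φ γ.fst) (h₂ : Integrable φ γ.snd) (ha : 0 < a) (hb : 0 < b)
    (hab : a + b = 1) (hint : Integrable φ (γ.map fun p => a • p.1 + b • p.2))
    (hle : a * ∫ x, φ x ∂γ.fst + b * ∫ x, φ x ∂γ.snd ≤
      ∫ x, φ x ∂(γ.map fun p => a • p.1 + b • p.2)) : γ.fst = γ.snd := by
  have hfst : Integrable (fun p => a * φ p.1) γ := (h₁.comp_measurable measurable_fst).const_mul a
  have hsnd : Integrable (fun p => b * φ p.2) γ := (h₂.comp_measurable measurable_snd).const_mul b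
  have hmix : Integrable (fun p => φ (a • p.1 + b • p.2)) γ := hint.comp_measurable (by fun_prop)
  have hdef : ∀ p : V × V, 0 ≤ a * φ p.1 + b * φ p.2 - φ (a • p.1 + b • p.2) := fun p =>
    sub_nonneg.2 (hφ.convexOn.2 (mem_univ _) (mem_univ _) ha.le hb.le hab)
  have hzero : ∫ p, (a * φ p.1 + b * φ p.2 - φ (a • p.1 + b • p.2)) ∂γ = 0 := by
    refine le_antisymm ?_ (integral_nonneg hdef)
    rw [integral_sub (f := fun p => a * φ p.1 + b * φ p.2) (hfst.add hsnd) hmix,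
      integral_add hfst hsnd, integral_const_mul, integral_const_mul, integral_comp_fst h₁.1,
      integral_comp_snd h₂.1]
    rw [integral_map (by fun_prop) hint.1] at hle
    linarith
  refine Measure.map_congr ?_
  filter_upwards [(integral_eq_zero_iff_of_nonneg hdef ((hfst.add hsnd).sub hmix)).1 hzero]
    with p hp
  by_contra hne
  exact (sub_pos.2 (hφ.2 (mem_univ p.1) (mem_univ p.2) hne ha hb hab)).ne' hp

end MixedLaws

/-- The measures `η` below `ν` for the convex order which admit a coupling with `μ` of correlation
at least `c`. For `c` the maximal correlation of the couplings of `μ` and `ν`, this is `I μ ν`. -/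
def corrSuperlevel {V : Type*} [NormedAddCommGroup V] [InnerProductSpace ℝ V] [MeasurableSpace V]
    (μ ν : Measure V) (c : ℝ) : Set (Measure V) :=
  {η | NonnegCxLE η ν ∧ ∃ π : Measure (V × V), (π.fst = μ ∧ π.snd = η) ∧ c ≤ corr π}

section CorrSuperlevel

variable {V : Type*} [NormedAddCommGroup V] [InnerProductSpace ℝ V] [MeasurableSpace V]
  {μ ν η η' : Measure V} {c : ℝ}

theorem isProbabilityMeasure_of_mem_corrSuperlevel [IsProbabilityMeasure μ]
    (h : η ∈ corrSuperlevel μ ν c) : IsProbabilityMeasure η := by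
  obtain ⟨-, π, ⟨hπ, rfl⟩, -⟩ := h
  have := isProbabilityMeasure_of_fst_eq hπ
  infer_instance

variable [FiniteDimensional ℝ V] [BorelSpace V]

theorem exists_map_add_smul_mem_corrSuperlevel [IsProbabilityMeasure μ] (hμ : MemLp id 2 μ)
    (hν : MemLp id 2 ν) (hη : η ∈ corrSuperlevel μ ν c) (hη' : η' ∈ corrSuperlevel μ ν c)
    {a b : ℝ} (ha : 0 ≤ a) (hb : 0 ≤ b) (hab : a + b = 1) :
    ∃ γ : Measure (V × V), (γ.fst = η ∧ γ.snd = η') ∧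
      γ.map (fun p => a • p.1 + b • p.2) ∈ corrSuperlevel μ ν c := by
  obtain ⟨hcx, π, ⟨hπ, rfl⟩, hcπ⟩ := hη
  obtain ⟨hcx', π', ⟨hπ', rfl⟩, hcπ'⟩ := hη'
  have := isProbabilityMeasure_of_fst_eq hπ
  have := isProbabilityMeasure_of_fst_eq hπ'
  have hint := integrable_inner_of_memLp (hπ ▸ hμ) (hcx.memLp_id_two hν)
  have hint' := integrable_inner_of_memLp (hπ' ▸ hμ) (hcx'.memLp_id_two hν)
  obtain ⟨γ, rfl, rfl⟩ := exists_gluing (hπ.trans hπ'.symm)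
  rw [Measure.fst_map_prodMk (by fun_prop)] at hπ
  rw [Measure.snd_map_prodMk measurable_fst] at hcx hcx'
  have hfst : γ.snd.fst = γ.map fun p => p.2.1 := Measure.map_map measurable_fst measurable_snd
  have hsnd : γ.snd.snd = γ.map fun p => p.2.2 := Measure.map_map measurable_snd measurable_snd
  refine ⟨γ.snd, ⟨?_, ?_⟩, .map_add_smul (hfst ▸ hcx) (hsnd ▸ hcx') ha hb hab,
    γ.map fun p => (p.1, a • p.2.1 + b • p.2.2), ⟨?_, ?_⟩, ?_⟩
  · rw [Measure.snd_map_prodMk measurable_fst, hfst]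
  · rw [Measure.snd_map_prodMk measurable_fst, hsnd]
  · rw [Measure.fst_map_prodMk (by fun_prop), hπ]
  · rw [Measure.snd_map_prodMk measurable_fst, Measure.snd,
      Measure.map_map (by fun_prop) measurable_snd]
    rfl
  · rw [corr_map_add_smul hint hint']
    calc c = a * c + b * c := by rw [← add_mul, hab, one_mul]
      _ ≤ _ := by gcongr

theorem eq_of_isMinOn_corrSuperlevel [IsProbabilityMeasure μ] [IsProbabilityMeasure ν]
    (hμ : MemLp id 2 μ) (hν : MemLp id 2 ν) {φ : V → ℝ} (hφ : StrictConvexOn ℝ univ φ)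
    (hφν : Integrable φ ν) (hη : η ∈ corrSuperlevel μ ν c) (hη' : η' ∈ corrSuperlevel μ ν c)
    (hmin : IsMinOn (fun ξ => ∫ x, φ x ∂ξ) (corrSuperlevel μ ν c) η)
    (hmin' : IsMinOn (fun ξ => ∫ x, φ x ∂ξ) (corrSuperlevel μ ν c) η') : η = η' := by
  have hint : ∀ {ξ}, ξ ∈ corrSuperlevel μ ν c → Integrable φ ξ := fun hξ => by
    have := isProbabilityMeasure_of_mem_corrSuperlevel hξ
    exact hξ.1.integrable (hν.integrable one_le_two) hφ.convexOn hφν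
  obtain ⟨γ, ⟨rfl, rfl⟩, hmem⟩ := exists_map_add_smul_mem_corrSuperlevel hμ hν hη hη'
    one_half_pos.le one_half_pos.le (add_halves 1)
  refine fst_eq_snd_of_strictConvexOn hφ (hint hη) (hint hη') one_half_pos one_half_pos
    (add_halves 1) (hint hmem) ?_
  have hle := isMinOn_iff.1 hmin _ hmem
  have hle' := isMinOn_iff.1 hmin' _ hmem
  linarith

theorem exists_isMinOn_corrSuperlevel_of_nonneg [IsProbabilityMeasure μ] (hμ : MemLp id 2 μ)
    (hν : MemLp id 2 ν) (hne : (corrSuperlevel μ ν c).Nonempty) {φ : V → ℝ}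
    (hφ : ConvexOn ℝ univ φ) (h0 : ∀ x, 0 ≤ φ x) (hφν : Integrable φ ν) :
    ∃ η ∈ corrSuperlevel μ ν c, IsMinOn (fun ξ => ∫ x, φ x ∂ξ) (corrSuperlevel μ ν c) η := by
  let S : Set ℝ := (fun ξ => ∫ x, φ x ∂ξ) '' corrSuperlevel μ ν c
  have hbdd : BddBelow S := ⟨0, by rintro - ⟨ξ, -, rfl⟩; exact integral_nonneg h0⟩
  obtain ⟨u, -, hu, hmem⟩ := exists_seq_tendsto_sInf (hne.image _) hbdd
  choose η hη hηu using hmem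
  choose hcx π hπ hc using hη
  have : ∀ n, IsProbabilityMeasure (π n) := fun n => isProbabilityMeasure_of_fst_eq (hπ n).1
  let s : ℕ → ProbabilityMeasure (V × V) := fun n => ⟨π n, this n⟩
  replace hcx : ∀ n, NonnegCxLE (s n : Measure (V × V)).snd ν := fun n => (hπ n).2.symm ▸ hcx n
  obtain ⟨ρ, k, hk, hlim, hρ, hcρ⟩ := exists_subseq_tendsto_le_corr (s := s) hμ
    (fun n => (hπ n).1) (fun n => (hcx n).memLp_id_two hν)
    (fun n => (hcx n).integral_le_of_nonneg strictConvexOn_norm_sq.convexOn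
      (fun y => sq_nonneg ‖y‖) (memLp_id_two_iff_integrable_norm_sq.1 hν)) tendsto_const_nhds hc
  have hsnd := ProbabilityMeasure.tendsto_map_of_tendsto_of_continuous _ _ hlim continuous_snd
  have hρcx := NonnegCxLE.of_tendsto hsnd fun n => hcx (k n)
  refine ⟨(ρ : Measure (V × V)).snd, ⟨hρcx, ρ, ⟨hρ, rfl⟩, hcρ⟩, isMinOn_iff.2 fun ξ hξ => ?_⟩
  calc ∫ x, φ x ∂(ρ : Measure (V × V)).snd
      ≤ sInf S := by
        refine (integrable_and_integral_le_of_tendsto hsnd (continuous_of_convexOn hφ) h0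
          (fun n => (hcx (k n)).integrable_of_nonneg hφ h0 hφν) (hu.comp hk.tendsto_atTop)
          fun n => ?_).2
        exact (congrArg (fun ξ => ∫ x, φ x ∂ξ) (hπ (k n)).2).trans_le (hηu (k n)).le
    _ ≤ ∫ x, φ x ∂ξ := csInf_le hbdd ⟨ξ, hξ, rfl⟩

theorem exists_isMinOn_corrSuperlevel [IsProbabilityMeasure μ] [IsProbabilityMeasure ν]
    (hμ : MemLp id 2 μ) (hν : MemLp id 2 ν) (hne : (corrSuperlevel μ ν c).Nonempty) {φ : V → ℝ}
    (hφ : ConvexOn ℝ univ φ) (hφν : Integrable φ ν) :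
    ∃ η ∈ corrSuperlevel μ ν c, IsMinOn (fun ξ => ∫ x, φ x ∂ξ) (corrSuperlevel μ ν c) η := by
  have hν' : Integrable id ν := hν.integrable one_le_two
  obtain ⟨L, a, hL⟩ := exists_clm_add_const_le hφ
  have haff := integrable_clm_add_const hν' L a
  obtain ⟨η, hη, hmin⟩ := exists_isMinOn_corrSuperlevel_of_nonneg hμ hν hne
    (hφ.sub (concaveOn_clm_add_const L a)) (fun x => sub_nonneg.2 (hL x)) (hφν.sub haff)
  have hsub : ∀ {ξ}, ξ ∈ corrSuperlevel μ ν c →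
      ∫ x, (φ x - (L x + a)) ∂ξ = ∫ x, φ x ∂ξ - ∫ x, (L x + a) ∂ν := fun {ξ} hξ => by
    have := isProbabilityMeasure_of_mem_corrSuperlevel hξ
    rw [integral_sub (hξ.1.integrable hν' hφ hφν)
      (integrable_clm_add_const (hξ.1.integrable_id hν') L a), hξ.1.integral_clm_add_const_eq hν']
  refine ⟨η, hη, isMinOn_iff.2 fun ξ hξ => ?_⟩
  have hle := isMinOn_iff.1 hmin ξ hξ
  simp only [Pi.sub_apply, hsub hη, hsub hξ] at hle
  linarith

end CorrSuperlevel

theorem NonnegCxLE.exists_snd_eq_le_corr {V : Type*} [NormedAddCommGroup V] [InnerProductSpace ℝ V]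
    [FiniteDimensional ℝ V] [MeasurableSpace V] [BorelSpace V] {η ν : Measure V}
    [IsProbabilityMeasure η] [IsProbabilityMeasure ν] (h : NonnegCxLE η ν) (hν : MemLp id 2 ν)
    {π : Measure (V × V)} (hπ : MemLp id 2 π.fst) (hπη : π.snd = η) :
    ∃ ρ : Measure (V × V), (ρ.fst = π.fst ∧ ρ.snd = ν) ∧ corr π ≤ corr ρ := by
  have : IsProbabilityMeasure (π.map Prod.swap) :=
    isProbabilityMeasure_of_fst_eq (Measure.fst_map_swap.trans hπη)
  obtain ⟨ρ, hρfst, hρsnd, hρ⟩ := NonnegCxLE.exists_le_corr hν (π := π.map Prod.swap)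
    (by rwa [Measure.fst_map_swap, hπη]) (by rwa [Measure.snd_map_swap])
  rw [Measure.snd_map_swap] at hρsnd
  rw [corr_map_swap] at hρ
  refine ⟨ρ.map Prod.swap, ⟨?_, ?_⟩, by rwa [corr_map_swap]⟩
  · rw [Measure.fst_map_swap, hρsnd]
  · rw [Measure.snd_map_swap, hρfst]

theorem integrable_of_convexOn_of_lintegral_lt_top {V : Type*} [NormedAddCommGroup V]
    [NormedSpace ℝ V] [FiniteDimensional ℝ V] [MeasurableSpace V] [BorelSpace V] {ν : Measure V}
    [IsFiniteMeasure ν] (hν : Integrable id ν) {φ : V → ℝ} (hφ : ConvexOn ℝ univ φ)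
    (hlt : ∫⁻ x, ENNReal.ofReal (φ x) ∂ν < ∞) : Integrable φ ν := by
  obtain ⟨L, c, hL⟩ := exists_clm_add_const_le hφ
  have hcont := continuous_of_convexOn hφ
  have haff := integrable_clm_add_const hν L c
  have hsub : Integrable (fun x => φ x - (L x + c)) ν := by
    refine ⟨by fun_prop, ?_⟩
    rw [hasFiniteIntegral_iff_ofReal (.of_forall fun x => sub_nonneg.2 (hL x))]
    calc ∫⁻ x, ENNReal.ofReal (φ x - (L x + c)) ∂ν
        ≤ ∫⁻ x, (ENNReal.ofReal (φ x) + ENNReal.ofReal (-(L x + c))) ∂ν :=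
          lintegral_mono fun x => by rw [sub_eq_add_neg]; exact ENNReal.ofReal_add_le
      _ = ∫⁻ x, ENNReal.ofReal (φ x) ∂ν + ∫⁻ x, ENNReal.ofReal (-(L x + c)) ∂ν :=
          lintegral_add_left (by fun_prop) _
      _ < ∞ := ENNReal.add_lt_top.2 ⟨hlt, haff.neg.lintegral_lt_top⟩
  exact (hsub.add haff).congr (.of_forall fun x => sub_add_cancel _ _)

variable {d : ℕ} {μ ν η η₀ : Measure (E d)} {φ : E d → ℝ}

theorem mem_P2_iff : μ ∈ P2 d ↔ IsProbabilityMeasure μ ∧ MemLp id 2 μ := by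
  rw [memLp_id_two_iff_integrable_norm_sq]
  refine and_congr_right fun _ => ?_
  simp only [Integrable, HasFiniteIntegral, enorm_pow, enorm_norm]
  exact (and_iff_right (by fun_prop)).symm

theorem extIntegral_of_nonneg (h0 : ∀ x, 0 ≤ φ x) :
    extIntegral η φ = ((∫⁻ x, ENNReal.ofReal (φ x) ∂η : ℝ≥0∞) : EReal) := by
  simp [extIntegral, ENNReal.ofReal_of_nonpos (neg_nonpos.2 (h0 _))]

theorem extIntegral_of_integrable (hφ : Integrable φ η) :
    extIntegral η φ = ((∫ x, φ x ∂η : ℝ) : EReal) := by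
  have hneg : ∫⁻ x, ENNReal.ofReal (-φ x) ∂η < ∞ := hφ.neg.lintegral_lt_top
  rw [integral_eq_lintegral_pos_part_sub_lintegral_neg_part hφ, EReal.coe_sub,
    EReal.coe_ennreal_toReal hφ.lintegral_lt_top.ne, EReal.coe_ennreal_toReal hneg.ne]
  rfl

theorem cxLE_iff_nonnegCxLE [IsProbabilityMeasure η] [IsProbabilityMeasure ν]
    (hν : Integrable id ν) : CxLE η ν ↔ NonnegCxLE η ν := by
  refine ⟨fun h φ hφ h0 => ?_, fun h φ hφ _ hsense => ?_⟩
  · have hsense : ∀ ρ : Measure (E d), IntegralMakesSense ρ φ := fun ρ =>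
      .inr (by simp [ENNReal.ofReal_of_nonpos (neg_nonpos.2 (h0 _))])
    have hle := h φ hφ (hsense η) (hsense ν)
    rwa [extIntegral_of_nonneg h0, extIntegral_of_nonneg h0,
      EReal.coe_ennreal_le_coe_ennreal_iff] at hle
  by_cases hlt : ∫⁻ x, ENNReal.ofReal (φ x) ∂ν < ∞
  · have hφν := integrable_of_convexOn_of_lintegral_lt_top hν hφ hlt
    have hφη := h.integrable hν hφ hφν
    rw [extIntegral_of_integrable hφη, extIntegral_of_integrable hφν, EReal.coe_le_coe_iff]
    exact h.integral_le hφ hφη hφν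
  · have htop : extIntegral ν φ = ⊤ := by
      rw [extIntegral, not_lt_top_iff.1 hlt,
        ← EReal.coe_ennreal_toReal (hsense.resolve_left hlt).ne]
      exact EReal.top_sub_coe _
    exact htop ▸ le_top

theorem toReal_W2sq (hμ : MemLp id 2 μ) (hν : MemLp id 2 ν) {π : Measure (E d × E d)}
    (hπ : π ∈ couplings μ ν) (hmax : ∀ π' ∈ couplings μ ν, corr π' ≤ corr π) :
    (W2sq μ ν).toReal = ∫ x, ‖x‖ ^ 2 ∂μ + ∫ y, ‖y‖ ^ 2 ∂ν - 2 * corr π := by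
  have hcost : ∀ π' ∈ couplings μ ν, ∫⁻ p, ‖p.2 - p.1‖ₑ ^ 2 ∂π' =
      ENNReal.ofReal (∫ x, ‖x‖ ^ 2 ∂μ + ∫ y, ‖y‖ ^ 2 ∂ν - 2 * corr π') := by
    rintro π' ⟨rfl, rfl⟩
    have hint := integrable_norm_smul_sub_smul_sq hμ hν 1 1
    have heq := integral_norm_smul_sub_smul_sq hμ hν 1 1
    simp only [one_smul, one_pow, one_mul, mul_one] at hint heq
    rw [← heq, ofReal_integral_eq_lintegral_ofReal hint (.of_forall fun p => sq_nonneg ‖_‖)]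
    refine lintegral_congr fun p => ?_
    rw [norm_sub_rev, ENNReal.ofReal_pow (norm_nonneg _), ofReal_norm]
  have hW : W2sq μ ν = ENNReal.ofReal (∫ x, ‖x‖ ^ 2 ∂μ + ∫ y, ‖y‖ ^ 2 ∂ν - 2 * corr π) := by
    refine le_antisymm ((iInf₂_le π hπ).trans_eq (hcost π hπ)) (le_iInf₂ fun π' hπ' => ?_)
    rw [hcost π' hπ']
    exact ENNReal.ofReal_le_ofReal (by linarith [hmax π' hπ'])
  rw [hW, ENNReal.toReal_ofReal]
  obtain ⟨rfl, rfl⟩ := hπ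
  exact sub_nonneg.2 (two_mul_corr_le hμ hν)

theorem I_eq_corrSuperlevel (hμ : μ ∈ P2 d) (hν : ν ∈ P2 d) {π : Measure (E d × E d)}
    (hπ : π ∈ couplings μ ν) (hmax : ∀ π' ∈ couplings μ ν, corr π' ≤ corr π) :
    I μ ν = corrSuperlevel μ ν (corr π) := by
  obtain ⟨hμprob, hμ2⟩ := mem_P2_iff.1 hμ
  obtain ⟨hνprob, hν2⟩ := mem_P2_iff.1 hν
  ext η
  constructor
  · rintro ⟨hη, hcx, heq⟩
    obtain ⟨hηprob, hη2⟩ := mem_P2_iff.1 hη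
    obtain ⟨ρ, hρ, hρmax⟩ := exists_corr_max hμ2 hη2
    rw [toReal_W2sq hμ2 hν2 hπ hmax,
      toReal_W2sq hμ2 hη2 hρ fun ρ' hρ' => hρmax ρ' hρ'.1 hρ'.2] at heq
    exact ⟨(cxLE_iff_nonnegCxLE (hν2.integrable one_le_two)).1 hcx, ρ, hρ, by linarith⟩
  · intro hη
    have hηprob := isProbabilityMeasure_of_mem_corrSuperlevel hη
    obtain ⟨hcx, ρ', hρ', hle⟩ := hη
    have hη2 := hcx.memLp_id_two hν2
    obtain ⟨ρ, hρ, hρmax⟩ := exists_corr_max hμ2 hη2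
    obtain ⟨π', hπ', hρπ'⟩ := hcx.exists_snd_eq_le_corr hν2 (hρ.1.symm ▸ hμ2) hρ.2
    have hπ'max := hmax π' ⟨hπ'.1.trans hρ.1, hπ'.2⟩
    refine ⟨mem_P2_iff.2 ⟨hηprob, hη2⟩,
      (cxLE_iff_nonnegCxLE (hν2.integrable one_le_two)).2 hcx, ?_⟩
    rw [toReal_W2sq hμ2 hν2 hπ hmax,
      toReal_W2sq hμ2 hη2 hρ fun ρ' hρ' => hρmax ρ' hρ'.1 hρ'.2]
    linarith [hρmax ρ' hρ'.1 hρ'.2]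

theorem exists_I_eq_corrSuperlevel (hμ : μ ∈ P2 d) (hν : ν ∈ P2 d) :
    ∃ c, I μ ν = corrSuperlevel μ ν c := by
  have := hμ.1
  have := hν.1
  obtain ⟨π, hπ, hmax⟩ := exists_corr_max (mem_P2_iff.1 hμ).2 (mem_P2_iff.1 hν).2
  exact ⟨corr π, I_eq_corrSuperlevel hμ hν hπ fun π' hπ' => hmax π' hπ'.1 hπ'.2⟩

theorem self_mem_I (hν : ν ∈ P2 d) : ν ∈ I μ ν :=
  ⟨hν, fun _ _ _ _ => le_rfl, (add_sub_cancel_right _ _).symm⟩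

theorem Admissible.integrable (hφ : Admissible ν φ) (hν : ν ∈ P2 d) : Integrable φ ν := by
  obtain ⟨hνprob, hν2⟩ := mem_P2_iff.1 hν
  exact integrable_of_convexOn_of_lintegral_lt_top (hν2.integrable one_le_two) hφ.1.convexOn hφ.2

theorem Admissible.integrable_of_mem_I (hφ : Admissible ν φ) (hν : ν ∈ P2 d) (hη : η ∈ I μ ν) :
    Integrable φ η := by
  obtain ⟨hνprob, hν2⟩ := mem_P2_iff.1 hν
  have hν1 := hν2.integrable one_le_two
  have := hη.1.1
  exact ((cxLE_iff_nonnegCxLE hν1).1 hη.2.1).integrable hν1 hφ.1.convexOn (hφ.integrable hν)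

theorem admissible_of_le_norm_sq (hν : ν ∈ P2 d) (hφ : StrictConvexOn ℝ univ φ) {K : ℝ}
    (hK : ∀ x, φ x ≤ K * (1 + ‖x‖ ^ 2)) : Admissible ν φ := by
  obtain ⟨hνprob, hν2⟩ := mem_P2_iff.1 hν
  have hint : Integrable (fun x => K * (1 + ‖x‖ ^ 2)) ν :=
    ((integrable_const 1).add (memLp_id_two_iff_integrable_norm_sq.1 hν2)).const_mul K
  exact ⟨hφ, (lintegral_mono fun x => ENNReal.ofReal_le_ofReal (hK x)).trans_lt
    hint.lintegral_lt_top⟩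

theorem admissible_norm_sq (hν : ν ∈ P2 d) : Admissible ν fun x => ‖x‖ ^ 2 :=
  admissible_of_le_norm_sq (K := 1) hν strictConvexOn_norm_sq fun x => by linarith

theorem mem_Iphi_iff_isMinOn (hν : ν ∈ P2 d) (hφ : Admissible ν φ) :
    η ∈ Iphi μ ν φ ↔ η ∈ I μ ν ∧ IsMinOn (fun ξ => ∫ x, φ x ∂ξ) (I μ ν) η := by
  refine and_congr_right fun hη => (forall₂_congr fun ξ hξ => ?_).trans isMinOn_iff.symm
  rw [extIntegral_of_integrable (hφ.integrable_of_mem_I hν hη),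
    extIntegral_of_integrable (hφ.integrable_of_mem_I hν hξ), EReal.coe_le_coe_iff]

theorem exists_Iphi_eq_singleton (hμ : μ ∈ P2 d) (hν : ν ∈ P2 d) (hφ : Admissible ν φ) :
    ∃ η, Iphi μ ν φ = {η} := by
  obtain ⟨hμprob, hμ2⟩ := mem_P2_iff.1 hμ
  obtain ⟨hνprob, hν2⟩ := mem_P2_iff.1 hν
  obtain ⟨c, hc⟩ := exists_I_eq_corrSuperlevel hμ hν
  have hne : (corrSuperlevel μ ν c).Nonempty := hc ▸ ⟨ν, self_mem_I hν⟩
  have hφν := hφ.integrable hν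
  obtain ⟨η, hη, hmin⟩ := exists_isMinOn_corrSuperlevel hμ2 hν2 hne hφ.1.convexOn hφν
  refine ⟨η, eq_singleton_iff_unique_mem.2 ⟨?_, fun ξ hξ => ?_⟩⟩
  · exact (mem_Iphi_iff_isMinOn hν hφ).2 (hc ▸ ⟨hη, hmin⟩)
  · obtain ⟨hξ, hξmin⟩ := hc ▸ (mem_Iphi_iff_isMinOn hν hφ).1 hξ
    exact eq_of_isMinOn_corrSuperlevel hμ2 hν2 hφ.1 hφν hξ hη hξmin hmin

theorem isEtaPhi_iff_Iphi_eq_singleton (hμ : μ ∈ P2 d) (hν : ν ∈ P2 d) (hφ : Admissible ν φ) :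
    IsEtaPhi μ ν φ η ↔ Iphi μ ν φ = {η} := by
  obtain ⟨ξ, hξ⟩ := exists_Iphi_eq_singleton hμ hν hφ
  rw [IsEtaPhi, hξ, singleton_eq_singleton_iff]
  exact ⟨fun h => h.1.symm, by rintro rfl; exact ⟨rfl, by rintro _ rfl; exact le_rfl⟩⟩

theorem existsUnique_isEtaPhi (hμ : μ ∈ P2 d) (hν : ν ∈ P2 d) (hφ : Admissible ν φ) :
    ∃! η, IsEtaPhi μ ν φ η := by
  obtain ⟨η, hη⟩ := exists_Iphi_eq_singleton hμ hν hφ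
  simp only [isEtaPhi_iff_Iphi_eq_singleton hμ hν hφ, hη]
  exact ⟨η, rfl, fun ξ hξ => (singleton_injective hξ).symm⟩

theorem setOf_isEtaPhi_eq_singleton_iff (hμ : μ ∈ P2 d) (hν : ν ∈ P2 d) :
    {η | ∃ φ : E d → ℝ, Admissible ν φ ∧ IsEtaPhi μ ν φ η} = {η₀} ↔
      ∀ φ, Admissible ν φ → Iphi μ ν φ = {η₀} := by
  constructor
  · intro h φ hφ
    obtain ⟨η, hη⟩ := exists_Iphi_eq_singleton hμ hν hφ
    have hmem : η ∈ ({η₀} : Set (Measure (E d))) :=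
      h ▸ ⟨φ, hφ, (isEtaPhi_iff_Iphi_eq_singleton hμ hν hφ).2 hη⟩
    rwa [mem_singleton_iff.1 hmem] at hη
  · intro h
    have hsq := admissible_norm_sq hν
    refine eq_singleton_iff_unique_mem.2
      ⟨⟨_, hsq, (isEtaPhi_iff_Iphi_eq_singleton hμ hν hsq).2 (h _ hsq)⟩, ?_⟩
    rintro η ⟨φ, hφ, hη⟩
    exact singleton_injective
      (((isEtaPhi_iff_Iphi_eq_singleton hμ hν hφ).1 hη).symm.trans (h φ hφ))

theorem Iphi_eq_singleton_of_I_eq_cxInterval (hμ : μ ∈ P2 d) (hν : ν ∈ P2 d) (hη₀ : η₀ ∈ P2 d)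
    (h : I μ ν = cxInterval η₀ ν) (hφ : Admissible ν φ) : Iphi μ ν φ = {η₀} := by
  have hη₀ν : CxLE η₀ ν := (h ▸ self_mem_I hν : ν ∈ cxInterval η₀ ν).2.1
  have hη₀I : η₀ ∈ I μ ν := h ▸ ⟨hη₀.1, fun _ _ _ _ => le_rfl, hη₀ν⟩
  have hsense : ∀ η ∈ I μ ν, IntegralMakesSense η φ := fun η hη =>
    .inl (hφ.integrable_of_mem_I hν hη).lintegral_lt_top
  have hmem : η₀ ∈ Iphi μ ν φ := ⟨hη₀I, fun η hη =>
    (h ▸ hη : η ∈ cxInterval η₀ ν).2.1 φ hφ.1.convexOn (hsense η₀ hη₀I) (hsense η hη)⟩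
  obtain ⟨ξ, hξ⟩ := exists_Iphi_eq_singleton hμ hν hφ
  rw [hξ] at hmem ⊢
  rw [mem_singleton_iff.1 hmem]

theorem I_eq_cxInterval_of_Iphi_eq_singleton (hμ : μ ∈ P2 d) (hν : ν ∈ P2 d)
    (h : ∀ φ, Admissible ν φ → Iphi μ ν φ = {η₀}) : I μ ν = cxInterval η₀ ν := by
  obtain ⟨hνprob, hν2⟩ := mem_P2_iff.1 hν
  have hmin : ∀ φ, Admissible ν φ → η₀ ∈ Iphi μ ν φ := fun φ hφ => (h φ hφ).superset rfl
  have hη₀ : η₀ ∈ I μ ν := (hmin _ (admissible_norm_sq hν)).1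
  have := hη₀.1.1
  refine Subset.antisymm (fun η hη => ?_) fun η hη => ?_
  · obtain ⟨hηprob, hη2⟩ := mem_P2_iff.1 hη.1
    refine ⟨hηprob, (cxLE_iff_nonnegCxLE (hη2.integrable one_le_two)).2 ?_, hη.2.1⟩
    refine nonnegCxLE_of_strictConvexOn hη2 fun φ hφ h0 ⟨K, hK⟩ => ?_
    have hle := (hmin φ (admissible_of_le_norm_sq hν hφ hK)).2 η hη
    rwa [extIntegral_of_nonneg h0, extIntegral_of_nonneg h0,
      EReal.coe_ennreal_le_coe_ennreal_iff] at hle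
  · obtain ⟨hηprob, hη₀η, hην⟩ := hη
    have hην' := (cxLE_iff_nonnegCxLE (hν2.integrable one_le_two)).1 hην
    have hη2 := hην'.memLp_id_two hν2
    obtain ⟨c, hc⟩ := exists_I_eq_corrSuperlevel hμ hν
    obtain ⟨-, π, hπ, hcπ⟩ := hc ▸ hη₀
    obtain ⟨ρ, hρ, hπρ⟩ := ((cxLE_iff_nonnegCxLE (hη2.integrable one_le_two)).1
      hη₀η).exists_snd_eq_le_corr hη2 (hπ.1.symm ▸ (mem_P2_iff.1 hμ).2) hπ.2
    exact hc ▸ ⟨hην', ρ, ⟨hρ.1.trans hπ.1, hρ.2⟩, hcπ.trans hπρ⟩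

end QuadOT

theorem corollary1 (d : ℕ) (μ ν : Measure (E d)) (hμ : μ ∈ P2 d) (hν : ν ∈ P2 d) :
    (∀ φ : E d → ℝ, Admissible ν φ → ∃! η, IsEtaPhi μ ν φ η) ∧
    ∃ ηmin : Measure (E d), Iphi μ ν (fun x => ‖x‖ ^ 2) = {ηmin} ∧
      ((∃ η₀ ∈ P2 d, I μ ν = cxInterval η₀ ν) ↔
        {η | ∃ φ : E d → ℝ, Admissible ν φ ∧ IsEtaPhi μ ν φ η} = {ηmin}) ∧
      ∀ η₀ ∈ P2 d, I μ ν = cxInterval η₀ ν → η₀ = ηmin := by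
  obtain ⟨ηmin, hηmin⟩ := exists_Iphi_eq_singleton hμ hν (admissible_norm_sq hν)
  have hbottom : ∀ η₀ ∈ P2 d, I μ ν = cxInterval η₀ ν → η₀ = ηmin := fun η₀ hη₀ h =>
    Set.singleton_injective <|
      (Iphi_eq_singleton_of_I_eq_cxInterval hμ hν hη₀ h (admissible_norm_sq hν)).symm.trans hηmin
  refine ⟨fun φ hφ => existsUnique_isEtaPhi hμ hν hφ, ηmin, hηmin, ?_, hbottom⟩
  rw [setOf_isEtaPhi_eq_singleton_iff hμ hν]
  constructor
  · rintro ⟨η₀, hη₀, h⟩ φ hφ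
    exact hbottom η₀ hη₀ h ▸ Iphi_eq_singleton_of_I_eq_cxInterval hμ hν hη₀ h hφ
  · intro h
    exact ⟨ηmin, (hηmin.superset rfl).1.1, I_eq_cxInterval_of_Iphi_eq_singleton hμ hν h⟩
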